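/- **Setting.** Let $M$ be a set, $u:M\to M$ a bijection, and for $\kappa\in\{s,c,u\}$ let $X^\kappa=(X^\kappa_m)_{m\in M}$ be a family of complete metric spaces; all distances are written $|x-y|$. Put $X_m=X^s_m\times X^c_m\times X^u_m$, $X^{cs}_m=X^s_m\times X^c_m$, $X^{cu}_m=X^c_m\times X^u_m$, with maximum metrics, and let $P^{cs},P^{cu},P^s,P^c,P^u$ denote the projections. A bundle correspondence $H$ over $u$ is a family of relations $H_m\subset X_m\times X_{u(m)}$; write $z'\in H_m(z)$ for $(z,z')\in H_m$. *Generating maps.* For families $Y^1,Y^2$ over $M$, and a bundle correspondence $H$ on $Y^1\times Y^2$ over $u$, write $H\sim(F,G)$ for maps $F_m:Y^1_m\times Y^2_{u(m)}\to Y^1_{u(m)}$, $G_m:Y^1_m\times Y^2_{u(m)}\to Y^2_m$ if $(x_2,y_2)\in H_m(x_1,y_1)\iff y_1=G_m(x_1,y_2),\ x_2=F_m(x_1,y_2)$. *(A)$(\alpha,\lambda)$ (B)$(\beta,\mu)$ condition.* For all $m$ and all $(x_2,y_2)\in H_m(x_1,y_1)$, $(x_2',y_2')\in H_m(x_1',y_1')$: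 (A) if $|x_1-x_1'|\le\alpha(m)|y_1-y_1'|$, then $|x_2-x_2'|\le\alpha(m)|y_2-y_2'|$ and $|y_1-y_1'|\le\lambda(m)|y_2-y_2'|$; (B) if $|y_2-y_2'|\le\beta(m)|x_2-x_2'|$, then $|y_1-y_1'|\le\beta(m)|x_1-x_1'|$ and $|x_2-x_2'|\le\mu(m)|x_1-x_1'|$. *Hypothesis (HT).* $H$ is a bundle correspondence on $X$ over $u$ such that $H\sim(F^{cs},G^{cs})$ on $X^{cs}\times X^u$ satisfies (A)$(\alpha_u,\lambda_u)$ (B)$(\beta_{cs},\lambda_{cs})$, and $H\sim(F^{cu},G^{cu})$ on $X^s\times X^{cu}$ satisfies (A)$(\alpha_{cu},\lambda_{cu})$ (B)$(\beta_s,\lambda_s)$. All eight functions $M\to[0,\infty)$ are bounded, and - $\sup_m\alpha_u(m)\beta_{cs}(u(m))<1$, $\sup_m\alpha_{cu}(m)\beta_s(u(m))<1$; $\alpha_\kappa(m)\le\alpha_\kappa(u(m))$ for $\kappa=u,cu$, and $\beta_\kappa(u(m))\le\beta_\kappa(m)$ for $\kappa=s,cs$; - $\alpha_{cu}\le1$,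 $\beta_{cs}\le1$, $\beta_{cs}\le\beta_s$, $\alpha_{cu}\le\alpha_u$, $\sup_m\alpha_u(m)\beta_s(m)<1$; - $\sup_m\lambda_u\lambda_{cs}<1$, $\sup_m\lambda_u<1$, $\sup_m\lambda_{cu}\lambda_s<1$, $\sup_m\lambda_s<1$. *Pseudo-invariant section.* A section $i=(i_1,i_2)$ of $Y^1\times Y^2$ is $1$-pseudo-invariant for $H\sim(F,G)$ if there is $\eta:M\to[0,\infty)$ with $\eta(u(m))=\eta(m)$, $|i_1(u(m))-F_m(i_1(m),i_2(u(m)))|\le\eta(u(m))$ and $|i_2(m)-G_m(i_1(m),i_2(u(m)))|\le\eta(m)$ for all $m$. *Orbits and rates.* A forward orbit from $m$ is $(z_k)_{k\ge0}$ with $z_k\in X_{u^k(m)}$, $z_{k+1}\in H_{u^k(m)}(z_k)$. A backward orbit from $m$ is $(z_{-k})_{k\ge0}$ with $z_{-k}\in X_{u^{-k}(m)}$, $z_{-k}\in H_{u^{-k-1}(m)}(z_{-k-1})$. For a function $\varepsilon$ over $v\in\{u,u^{-1}\}$, $\varepsilon^{(k)}(m)=\prod_{j=0}^{k-1}\varepsilon(v^j(m))$;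 and $a_k\lesssim b_k$ means $\sup_{k\ge0}b_k^{-1}a_k<\infty$. An intersection or a graph "of $A\to B$" is understood inside $X_m$ after the evident reordering of factors. **Theorem.** Assume (HT), and let $i$ be a section of $X$ that is $1$-pseudo-invariant for $H$, with respect to $(F^{cs},G^{cs})$ or with respect to $(F^{cu},G^{cu})$. Let $\varsigma>0$, and let $\hat\varepsilon_1,\tilde\varepsilon_1$ (over $u$) and $\hat\varepsilon_2,\tilde\varepsilon_2$ (over $u^{-1}$) be real functions on $M$ such that for all $m$ $$\lambda_{cs}(m)+\varsigma<\hat\varepsilon_1(m),\quad \lambda_{cu}(m)+\varsigma<\hat\varepsilon_2(m),\quad \lambda_s(m)+\varsigma<\tilde\varepsilon_1(m),\quad \lambda_u(m)+\varsigma<\tilde\varepsilon_2(m),$$ $\hat\varepsilon_1,\hat\varepsilon_2\ge1$, and $\sup_m\lambda_u\hat\varepsilon_1<1$, $\sup_m\lambda_s\hat\varepsilon_2<1$, $\sup_m\lambda_{cu}\tilde\varepsilon_1<1$, $\sup_m\lambda_{cs}\tilde\varepsilon_2<1$. Then there are sets $W^{cs}_m,W^{cu}_m\subset X_m$ $(m\in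 M)$ such that, with $W^c_m=W^{cs}_m\cap W^{cu}_m$, the following hold. (1) For every $m$, $W^{cs}_m$ is the graph of a map $X^{cs}_m\to X^u_m$ with Lipschitz constant at most $\beta_{cs}(m)$, and $W^{cu}_m$ is the graph of a map $X^{cu}_m\to X^s_m$ with Lipschitz constant at most $\alpha_{cu}(m)$. Every $z\in W^{cs}_m$ has some $z'\in H_m(z)\cap W^{cs}_{u(m)}$; every $z\in W^{cu}_m$ lies in $H_{u^{-1}(m)}(z')$ for some $z'\in W^{cu}_{u^{-1}(m)}$. Moreover $W^{cs}_m$ is the set of all $z_0\in X_m$ from which there is a forward orbit with $|z_k-i(u^k(m))|\lesssim\hat\varepsilon_1^{(k)}(m)$, and $W^{cu}_m$ is the set of all $z_0\in X_m$ from which there is a backward orbit with $|z_{-k}-i(u^{-k}(m))|\lesssim\hat\varepsilon_2^{(k)}(m)$. (2) There is $K$ such that every $W^c_m$ is the graph of a $K$-Lipschitz map $X^c_m\to X^s_m\times X^u_m$. Every $z\in W^c_m$ has some $z'\in H_m(z)\cap W^c_{u(m)}$ and lies in $H_{u^{-1}(m)}(z'')$ for some $z''\in W^c_{u^{-1}(m)}$.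 The set $W^{cs}_m$ equals the set of $z_0\in X_m$ from which there is a forward orbit with $d(z_k,W^c_{u^k(m)})\to0$, and also the set of those from which there is a forward orbit with $\sup_kd(z_k,W^c_{u^k(m)})<\infty$. The same holds for $W^{cu}_m$, with backward orbits and $d(z_{-k},W^c_{u^{-k}(m)})$. (3) For every forward orbit $(z_k)$ from $m$ there is a forward orbit $(\bar z_k)$ from $m$ with $\bar z_k\in W^{cu}_{u^k(m)}$ for all $k$ and $|z_k-\bar z_k|\lesssim\tilde\varepsilon_1^{(k)}(m)$. For every backward orbit $(z_{-k})$ from $m$ there is a backward orbit $(\bar z_{-k})$ from $m$ with $\bar z_{-k}\in W^{cs}_{u^{-k}(m)}$ for all $k$ and $|z_{-k}-\bar z_{-k}|\lesssim\tilde\varepsilon_2^{(k)}(m)$. (4) $H$ induces bundle maps $H^{cs}:W^{cs}\to W^{cs}$ and $H^c:W^c\to W^c$ over $u$, and $H^{-1}$ induces a bundle map $H^{-cu}:W^{cu}\to W^{cu}$ over $u^{-1}$: $H^{cs}_m(z)$ is the only point of $H_m(z)\cap W^{cs}_{u(m)}$, $H^c_m(z)$ is the only point of $H_m(z)\cap W^c_{u(m)}$,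 and $H^{-cu}_m(z)$ is the only $z'\in W^{cu}_{u^{-1}(m)}$ with $z\in H_{u^{-1}(m)}(z')$. There are bundle maps $h^{cs}:X^{cs}\to X^{cs}$ over $u$, $h^{-cu}:X^{cu}\to X^{cu}$ over $u^{-1}$, and $h^c:X^c\to X^c$ over $u$ with bijective fiber maps, such that $$P^{cs}H^{cs}=h^{cs}P^{cs}\text{ on }W^{cs},\qquad P^{cu}H^{-cu}=h^{-cu}P^{cu}\text{ on }W^{cu},\qquad P^cH^c=h^cP^c\text{ on }W^c,$$ $\operatorname{Lip}h^{cs}_m\le\lambda_{cs}(m)$, $\operatorname{Lip}h^c_m\le\lambda_{cs}(m)$, $\operatorname{Lip}(h^c_m)^{-1}\le\lambda_{cu}(m)$, and the fiber map $h^{-cu}_m:X^{cu}_m\to X^{cu}_{u^{-1}(m)}$ has $\operatorname{Lip}h^{-cu}_m\le\lambda_{cu}(u^{-1}(m))$. (5) For $z\in W^{cs}_m$ there is a set $W^{ss}_z\subset W^{cs}_m$ containing $z$, and for $z\in W^{cu}_m$ there is a set $W^{uu}_z\subset W^{cu}_m$ containing $z$, such that $W^{ss}_z$ is the graph of a map $X^s_m\to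 X^{cu}_m$ with Lipschitz constant at most $\beta_s(m)$, $W^{uu}_z$ is the graph of a map $X^u_m\to X^{cs}_m$ with Lipschitz constant at most $\alpha_u(m)$, $H^{cs}_mW^{ss}_z\subset W^{ss}_{H^{cs}_m(z)}$ and $H^{-cu}_mW^{uu}_z\subset W^{uu}_{H^{-cu}_m(z)}$. For $z,z'\in W^{cs}_m$: $z'\in W^{ss}_z$ if and only if $|(H^{cs})^{(k)}_m(z')-(H^{cs})^{(k)}_m(z)|\lesssim\tilde\varepsilon_1^{(k)}(m)$. For $z,z'\in W^{cu}_m$: $z'\in W^{uu}_z$ if and only if $|(H^{-cu})^{(k)}_m(z')-(H^{-cu})^{(k)}_m(z)|\lesssim\tilde\varepsilon_2^{(k)}(m)$. For every $m$ there are surjections $W^{cs}_m\to W^c_m$ and $W^{cu}_m\to W^c_m$ whose fibers over $w\in W^c_m$ are $W^{ss}_w$ and $W^{uu}_w$ respectively. Finally the product bundle $W^{cs}\times W^{cu}$ over $W^c$, with fiber $W^{ss}_w\times W^{uu}_w$ over $w$, is isomorphic to $X^s\times X^c\times X^u$: for every $m$, $(w,z_s,z_u)\mapsto(P^sz_s,P^cw,P^uz_u)$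 is a bijection from $\{(w,z_s,z_u):w\in W^c_m,\ z_s\in W^{ss}_w,\ z_u\in W^{uu}_w\}$ onto $X_m$. -/

import Mathlib

open scoped NNReal Topology
open Filter

namespace HypTri

universe v w w₁ w₂ w₃

/-! ### Correspondences, generating maps, the (A)(B) condition -/

section Single

variable {X₁ : Type*} {Y₁ : Type*} {X₂ : Type*} {Y₂ : Type*}

/-- The correspondence `X₁ × Y₁ → X₂ × Y₂` with graph `R` (read `R x₁ y₁ x₂ y₂` as
`(x₂, y₂) ∈ H (x₁, y₁)`) has the generating map `(F, G)`. -/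
def HasGeneratingMap (R : X₁ → Y₁ → X₂ → Y₂ → Prop) (F : X₁ → Y₂ → X₂) (G : X₁ → Y₂ → Y₁) :
    Prop :=
  ∀ x₁ y₁ x₂ y₂, R x₁ y₁ x₂ y₂ ↔ y₁ = G x₁ y₂ ∧ x₂ = F x₁ y₂

variable [MetricSpace X₁] [MetricSpace Y₁] [MetricSpace X₂] [MetricSpace Y₂]

/-- The (A)`(α, lu)` condition. -/
def ConditionA (R : X₁ → Y₁ → X₂ → Y₂ → Prop) (α lu : ℝ≥0) : Prop :=
  ∀ x₁ y₁ x₂ y₂ x₁' y₁' x₂' y₂', R x₁ y₁ x₂ y₂ → R x₁' y₁' x₂' y₂' →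
    dist x₁ x₁' ≤ α * dist y₁ y₁' →
      dist x₂ x₂' ≤ α * dist y₂ y₂' ∧ dist y₁ y₁' ≤ lu * dist y₂ y₂'

/-- The (B)`(β, ls)` condition. -/
def ConditionB (R : X₁ → Y₁ → X₂ → Y₂ → Prop) (β ls : ℝ≥0) : Prop :=
  ∀ x₁ y₁ x₂ y₂ x₁' y₁' x₂' y₂', R x₁ y₁ x₂ y₂ → R x₁' y₁' x₂' y₂' →
    dist y₂ y₂' ≤ β * dist x₂ x₂' →
      dist y₁ y₁' ≤ β * dist x₁ x₁' ∧ dist x₂ x₂' ≤ ls * dist x₁ x₁'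

end Single

/-! ### Base dynamics, cocycles, orbits -/

/-- The orbit `m, v m, v (v m), …`. -/
def baseOrbit {M : Type v} (v : M → M) (m : M) : ℕ → M
  | 0 => m
  | k + 1 => v (baseOrbit v m k)

/-- `e⁽ᵏ⁾(m) = e(vᵏ⁻¹ m) ⋯ e(v m) e(m)`, for a function `e` over `v`. -/
def cocycle {M : Type v} (v : M → M) (e : M → ℝ) (m : M) (k : ℕ) : ℝ :=
  ∏ j ∈ Finset.range k, e (baseOrbit v m j)

/-- `aₙ ≲ bₙ`, i.e. `sup bₙ⁻¹ aₙ < ∞` (used for positive `b` only). -/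
def Dominated (a b : ℕ → ℝ) : Prop :=
  BddAbove (Set.range fun k => (b k)⁻¹ * a k)

/-- `sup_m f(m) < 1`. -/
def SupLTOne {M : Type v} (f : M → ℝ) : Prop :=
  ∃ θ < 1, ∀ m, f m ≤ θ

/-- The growth rate `e` is uniformly above `lo` and uniformly below `1 / hi`. -/
def AdmissibleRate {M : Type v} (lo hi : M → ℝ≥0) (ς : ℝ) (e : M → ℝ) : Prop :=
  (∀ m, (lo m : ℝ) + ς < e m) ∧ SupLTOne fun m => (hi m : ℝ) * e m

section Bundle

variable {M : Type v} {Z : M → Type w}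

/-- The `k`-th composition `f⁽ᵏ⁾_m : Z_m → Z_{vᵏ m}` of a bundle map `f` over `v`. -/
def iterateMap {v : M → M} (f : ∀ m, Z m → Z (v m)) (m : M) :
    ∀ k : ℕ, Z m → Z (baseOrbit v m k)
  | 0 => fun z => z
  | k + 1 => fun z => f (baseOrbit v m k) (iterateMap f m k z)

/-- The graph of the bundle correspondence `H` over `u` in the total space: `z` lies over `m`,
`z'` lies over `m'`, where `m' = u m` and `z' ∈ H_m(z)`. -/
def Step {u : Equiv.Perm M} (H : ∀ m, Z m → Z (u m) → Prop) {m m' : M} (z : Z m) (z' : Z m') :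
    Prop :=
  ∃ h : m' = u m, H m z (h ▸ z')

/-- `z` is a forward orbit of `H` from `m`. -/
def IsForwardOrbit {u : Equiv.Perm M} (H : ∀ m, Z m → Z (u m) → Prop) (m : M)
    (z : ∀ k, Z (baseOrbit u m k)) : Prop :=
  ∀ k, H (baseOrbit u m k) (z k) (z (k + 1))

/-- `z` is a backward orbit of `H` from `m`; here `z k` lies over `u⁻ᵏ m` and is
usually written `z_{-k}`. -/
def IsBackwardOrbit {u : Equiv.Perm M} (H : ∀ m, Z m → Z (u m) → Prop) (m : M)
    (z : ∀ k, Z (baseOrbit u.symm m k)) : Prop :=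
  ∀ k, Step H (z (k + 1)) (z k)

end Bundle

/-- `i = (iX, iY)` is an `ε`-pseudo-invariant section of the bundle correspondence over `u` with
generating bundle map `(F, G)`. -/
def IsPseudoInvariantSection {M : Type v} {X : M → Type w₁} {Y : M → Type w₂}
    [∀ m, MetricSpace (X m)] [∀ m, MetricSpace (Y m)] (u : Equiv.Perm M)
    (F : ∀ m, X m → Y (u m) → X (u m)) (G : ∀ m, X m → Y (u m) → Y m)
    (ε : M → ℝ≥0) (iX : ∀ m, X m) (iY : ∀ m, Y m) : Prop :=
  ∃ η : M → ℝ≥0,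
    (∀ m, dist (iX (u m)) (F m (iX m) (iY (u m))) ≤ η (u m)) ∧
    (∀ m, dist (iY m) (G m (iX m) (iY (u m))) ≤ η m) ∧
    (∀ m, η (u m) ≤ ε m * η m) ∧ (∀ m, η m ≤ ε m * η (u m))

/-! ### The trichotomy hypothesis -/

section Trichotomy

variable {M : Type v} {Xs : M → Type w₁} {Xc : M → Type w₂} {Xu : M → Type w₃}

/-- The correspondence `H_m`, read on `(Xˢ × Xᶜ) × Xᵘ`. -/
def groupCS {u : Equiv.Perm M}
    (H : ∀ m, Xs m × Xc m × Xu m → Xs (u m) × Xc (u m) × Xu (u m) → Prop) (m : M)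
    (x : Xs m × Xc m) (y : Xu m) (x' : Xs (u m) × Xc (u m)) (y' : Xu (u m)) : Prop :=
  H m (x.1, x.2, y) (x'.1, x'.2, y')

/-- The correspondence `H_m`, read on `Xˢ × (Xᶜ × Xᵘ)`. -/
def groupCU {u : Equiv.Perm M}
    (H : ∀ m, Xs m × Xc m × Xu m → Xs (u m) × Xc (u m) × Xu (u m) → Prop) (m : M)
    (x : Xs m) (y : Xc m × Xu m) (x' : Xs (u m)) (y' : Xc (u m) × Xu (u m)) : Prop :=
  H m (x, y) (x', y')

variable [∀ m, MetricSpace (Xs m)] [∀ m, MetricSpace (Xc m)] [∀ m, MetricSpace (Xu m)]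

/-- The hyperbolic trichotomy hypothesis (HT). Products carry the maximum metric. -/
structure HT (u : Equiv.Perm M)
    (H : ∀ m, Xs m × Xc m × Xu m → Xs (u m) × Xc (u m) × Xu (u m) → Prop)
    (Fcs : ∀ m, Xs m × Xc m → Xu (u m) → Xs (u m) × Xc (u m))
    (Gcs : ∀ m, Xs m × Xc m → Xu (u m) → Xu m)
    (Fcu : ∀ m, Xs m → Xc (u m) × Xu (u m) → Xs (u m))
    (Gcu : ∀ m, Xs m → Xc (u m) × Xu (u m) → Xc m × Xu m)
    (αu lu βcs lcs αcu lcu βs ls : M → ℝ≥0) : Prop where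
  gen_cs : ∀ m, HasGeneratingMap (groupCS H m) (Fcs m) (Gcs m)
  gen_cu : ∀ m, HasGeneratingMap (groupCU H m) (Fcu m) (Gcu m)
  condA_cs : ∀ m, ConditionA (groupCS H m) (αu m) (lu m)
  condB_cs : ∀ m, ConditionB (groupCS H m) (βcs m) (lcs m)
  condA_cu : ∀ m, ConditionA (groupCU H m) (αcu m) (lcu m)
  condB_cu : ∀ m, ConditionB (groupCU H m) (βs m) (ls m)
  bdd_αu : BddAbove (Set.range αu)
  bdd_lu : BddAbove (Set.range lu)
  bdd_βcs : BddAbove (Set.range βcs)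
  bdd_lcs : BddAbove (Set.range lcs)
  bdd_αcu : BddAbove (Set.range αcu)
  bdd_lcu : BddAbove (Set.range lcu)
  bdd_βs : BddAbove (Set.range βs)
  bdd_ls : BddAbove (Set.range ls)
  angle_cs : SupLTOne fun m => (αu m : ℝ) * βcs (u m)
  angle_cu : SupLTOne fun m => (αcu m : ℝ) * βs (u m)
  mono_αu : ∀ m, αu m ≤ αu (u m)
  mono_αcu : ∀ m, αcu m ≤ αcu (u m)
  anti_βcs : ∀ m, βcs (u m) ≤ βcs m
  anti_βs : ∀ m, βs (u m) ≤ βs m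
  αcu_le_one : ∀ m, αcu m ≤ 1
  βcs_le_one : ∀ m, βcs m ≤ 1
  βcs_le_βs : ∀ m, βcs m ≤ βs m
  αcu_le_αu : ∀ m, αcu m ≤ αu m
  angle_su : SupLTOne fun m => (αu m : ℝ) * βs m
  spec_cs : SupLTOne fun m => (lu m : ℝ) * lcs m
  spec_u : SupLTOne fun m => (lu m : ℝ)
  spec_cu : SupLTOne fun m => (lcu m : ℝ) * ls m
  spec_s : SupLTOne fun m => (ls m : ℝ)

end Trichotomy

end HypTri

open HypTri

namespace HypTri

/-! The theorem is a Hadamard graph transform argument. The trichotomy contains two dichotomies, one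
on `Xcs × Xu` and one on `Xs × Xcu`. Inverting `H` exchanges (A) and (B) and the two factors, so
each dichotomy has a dual over the inverse base map. Everything is therefore proved once for an
abstract `Dichotomy` and used for `Dcs`, `Ds`, `Dcu = Ds.dual` and `Du = Dcs.dual`. The base map `v`
is arbitrary, so that an orbit can also be treated as a bundle over `ℕ`.

Existence (`Dichotomy.exists_graph`): above a given `x`, exactly one step ends on a given
`β`-Lipschitz graph, because `α β < 1` gives a contraction, and by (B) the starting points form a
`β`-Lipschitz graph again. This is the transform `T`. Its iterates from the constant family through
the section stay uniformly near the section (`exists_uniform_near`). Two consecutive iterates at `x`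
differ by the final separation of two `n`-step orbits, shrunk by the product of `lu`. That
separation grows at most like the product of `ls` plus accumulated errors, so `lu * ls ≤ θ < 1`
leaves a bound of order `n θ ^ n`, which is summable. The limit is an invariant graph.

Characterization (`orbit_zero_eq`): if two orbits start with the same `px`, (A) bounds their initial
`py`-distance by the product of `lu` times the distance at time `k`. If the latter grows slowly
enough, the orbits start at the same point. Comparison with an orbit in the graph shows that the
graph consists of the starting points of orbits with the prescribed growth.

An orbit is an exactly invariant section over `ℕ`. The existence theorem for it yields a leaf of
points asymptotic to the orbit (`exists_leaf`). Leaves give the strong foliations, and intersecting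
a leaf with a transverse graph gives tracking orbits and the projections onto the center. The center
itself is the intersection of two transverse Lipschitz graphs, parametrized by `Xc`. -/

/-- A correspondence `R` over `v` on a bundle `Z` that splits as `X × Y` through the projections
`px`, `py`, has a generating map, and satisfies the (A)`(α, lu)` (B)`(β, ls)` condition with the
angle and spectral conditions of a dichotomy. -/
structure Dichotomy {M : Type*} {Z X Y : M → Type*} [∀ m, MetricSpace (Z m)]
    [∀ m, MetricSpace (X m)] [∀ m, MetricSpace (Y m)] (v : M → M)
    (R : ∀ m, Z m → Z (v m) → Prop) (px : ∀ m, Z m → X m) (py : ∀ m, Z m → Y m)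
    (α lu β ls : M → ℝ≥0) : Prop where
  dist_eq : ∀ m (z w : Z m), dist z w = max (dist (px m z) (px m w)) (dist (py m z) (py m w))
  exists_mk : ∀ m x y, ∃ z, px m z = x ∧ py m z = y
  gen : ∀ m x y, ∃ z z', R m z z' ∧ px m z = x ∧ py (v m) z' = y
  condA : ∀ m z z' w w', R m z z' → R m w w' →
    dist (px m z) (px m w) ≤ α m * dist (py m z) (py m w) →
    dist (px (v m) z') (px (v m) w') ≤ α m * dist (py (v m) z') (py (v m) w') ∧
      dist (py m z) (py m w) ≤ lu m * dist (py (v m) z') (py (v m) w')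
  condB : ∀ m z z' w w', R m z z' → R m w w' →
    dist (py (v m) z') (py (v m) w') ≤ β m * dist (px (v m) z') (px (v m) w') →
    dist (py m z) (py m w) ≤ β m * dist (px m z) (px m w) ∧
      dist (px (v m) z') (px (v m) w') ≤ ls m * dist (px m z) (px m w)
  mono : ∀ m, α m ≤ α (v m)
  anti : ∀ m, β (v m) ≤ β m
  angle : SupLTOne fun m => (α m : ℝ) * β m
  spec : SupLTOne fun m => (lu m : ℝ) * ls m
  bdd : ∃ K : ℝ, ∀ m, (α m : ℝ) ≤ K ∧ (lu m : ℝ) ≤ K ∧ (β m : ℝ) ≤ K ∧ (ls m : ℝ) ≤ K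

theorem exists_fixedPoint_of_dist_le {Y : Type*} [MetricSpace Y] [CompleteSpace Y] (y₀ : Y)
    (Φ : Y → Y) {θ : ℝ} (hθ : θ < 1) (h : ∀ y y', dist (Φ y) (Φ y') ≤ θ * dist y y') :
    ∃ y, Φ y = y := by
  have hc : ContractingWith (Real.toNNReal θ) Φ := by
    refine ⟨by simpa using hθ, LipschitzWith.of_dist_le_mul fun y y' => (h y y').trans ?_⟩
    exact mul_le_mul_of_nonneg_right (Real.le_coe_toNNReal θ) dist_nonneg
  have : Nonempty Y := ⟨y₀⟩
  exact ⟨_, hc.fixedPoint_isFixedPt⟩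

/-- The `n`-step correspondence of `R`. -/
def stepN {M : Type*} {Z : M → Type*} {v : M → M} (R : ∀ m, Z m → Z (v m) → Prop) :
    ∀ n m, Z m → Z (v^[n] m) → Prop
  | 0, _, z, z' => z' = z
  | n + 1, m, z, z' => ∃ w, R m z w ∧ stepN R n (v m) w z'

/-- The cocycle product `e m * e (v m) * ⋯` with `n` factors. -/
def prodN {M : Type*} (v : M → M) (e : M → ℝ≥0) : ℕ → M → ℝ≥0
  | 0, _ => 1
  | n + 1, m => e m * prodN v e n (v m)

theorem SupLTOne.exists_pos {M : Type*} {f : M → ℝ} (h : SupLTOne f) :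
    ∃ θ, 0 < θ ∧ θ < 1 ∧ ∀ m, f m ≤ θ := by
  obtain ⟨θ, h1, h⟩ := h
  exact ⟨max θ (1 / 2), by positivity, by simp [h1]; norm_num, fun m => (h m).trans (le_max_left _ _)⟩

/-! ### Cone estimates for a single step. -/

namespace Dichotomy

variable {M : Type*} {Z X Y : M → Type*} [∀ m, MetricSpace (Z m)]
  [∀ m, MetricSpace (X m)] [∀ m, MetricSpace (Y m)] {v : M → M}
  {R : ∀ m, Z m → Z (v m) → Prop} {px : ∀ m, Z m → X m} {py : ∀ m, Z m → Y m}
  {α lu β ls : M → ℝ≥0}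

theorem ext (D : Dichotomy v R px py α lu β ls) {m} {z w : Z m} (hx : px m z = px m w)
    (hy : py m z = py m w) : z = w := by
  rw [← dist_eq_zero, D.dist_eq]
  simp [hx, hy]

theorem dist_px_le (D : Dichotomy v R px py α lu β ls) {m} (z w : Z m) :
    dist (px m z) (px m w) ≤ dist z w := by
  rw [D.dist_eq]; exact le_max_left _ _

theorem dist_py_le (D : Dichotomy v R px py α lu β ls) {m} (z w : Z m) :
    dist (py m z) (py m w) ≤ dist z w := by
  rw [D.dist_eq]; exact le_max_right _ _

theorem condA_of_eq (D : Dichotomy v R px py α lu β ls) {m} {z w : Z m} {z' w' : Z (v m)}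
    (h : R m z z') (k : R m w w') (hx : px m z = px m w) :
    dist (px (v m) z') (px (v m) w') ≤ α m * dist (py (v m) z') (py (v m) w') ∧
      dist (py m z) (py m w) ≤ lu m * dist (py (v m) z') (py (v m) w') :=
  D.condA m z z' w w' h k (by rw [hx, dist_self]; positivity)

theorem condB_of_eq (D : Dichotomy v R px py α lu β ls) {m} {z w : Z m} {z' w' : Z (v m)}
    (h : R m z z') (k : R m w w') (hy : py (v m) z' = py (v m) w') :
    dist (py m z) (py m w) ≤ β m * dist (px m z) (px m w) ∧
      dist (px (v m) z') (px (v m) w') ≤ ls m * dist (px m z) (px m w) :=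
  D.condB m z z' w w' h k (by rw [hy, dist_self]; positivity)

/-- Two steps that end on one and the same `β`-Lipschitz graph are in the cone of (B). -/
theorem condB_of_graph (D : Dichotomy v R px py α lu β ls) {m} {z w : Z m} {z' w' : Z (v m)}
    (h : R m z z') (k : R m w w') {f : X (v m) → Y (v m)} (hf : LipschitzWith (β (v m)) f)
    (hz : py (v m) z' = f (px (v m) z')) (hw : py (v m) w' = f (px (v m) w')) :
    dist (py m z) (py m w) ≤ β m * dist (px m z) (px m w) ∧
      dist (px (v m) z') (px (v m) w') ≤ ls m * dist (px m z) (px m w) := by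
  refine D.condB m z z' w w' h k ?_
  rw [hz, hw]
  refine (hf.dist_le_mul _ _).trans ?_
  gcongr
  exact D.anti m

/-- Both forms of the angle bound with one constant: cones are compared over one fiber, but one step
compares the cone over `m` with a graph over `v m`. -/
theorem angle_step (D : Dichotomy v R px py α lu β ls) :
    ∃ θ, 0 < θ ∧ θ < 1 ∧ (∀ m, (α m : ℝ) * β m ≤ θ) ∧ ∀ m, (α m : ℝ) * β (v m) ≤ θ := by
  obtain ⟨θ, h0, h1, h⟩ := D.angle.exists_pos
  refine ⟨θ, h0, h1, h, fun m => le_trans ?_ (h m)⟩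
  gcongr
  exact D.anti m

theorem bdd_pos (D : Dichotomy v R px py α lu β ls) :
    ∃ K : ℝ, 0 < K ∧
      ∀ m, (α m : ℝ) ≤ K ∧ (lu m : ℝ) ≤ K ∧ (β m : ℝ) ≤ K ∧ (ls m : ℝ) ≤ K := by
  obtain ⟨K, h⟩ := D.bdd
  refine ⟨max K 1, by positivity, fun m => ?_⟩
  obtain ⟨h1, h2, h3, h4⟩ := h m
  simp [h1, h2, h3, h4]

/-- Prescribe `y` at the end and `x` at the start. By (A) the resulting end point moves by at most
`α m` per unit of `y`, so `y ↦ f (px z')` contracts with factor `α m * β (v m)`, and its fixed point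
ends on the graph. -/
theorem exists_step_to_graph [∀ m, CompleteSpace (Y m)] (D : Dichotomy v R px py α lu β ls)
    (m : M) (y₀ : Y (v m)) {f : X (v m) → Y (v m)} (hf : LipschitzWith (β (v m)) f) (x : X m) :
    ∃ z z', R m z z' ∧ px m z = x ∧ py (v m) z' = f (px (v m) z') := by
  choose z z' h hx hy using D.gen m x
  obtain ⟨θ, _, h1, _, h2⟩ := D.angle_step
  obtain ⟨y, hfix⟩ := exists_fixedPoint_of_dist_le y₀ (fun y => f (px (v m) (z' y))) h1
    (fun y y' => by
      have hA := (D.condA_of_eq (h y) (h y') ((hx y).trans (hx y').symm)).1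
      rw [hy, hy] at hA
      calc dist (f (px (v m) (z' y))) (f (px (v m) (z' y')))
          ≤ β (v m) * dist (px (v m) (z' y)) (px (v m) (z' y')) := hf.dist_le_mul _ _
        _ ≤ β (v m) * (α m * dist y y') := by gcongr
        _ = (α m * β (v m)) * dist y y' := by ring
        _ ≤ θ * dist y y' := by gcongr; exact h2 m)
  exact ⟨z y, z' y, h y, hx y, by rw [hy]; exact hfix.symm⟩

end Dichotomy

/-! ### The graph transform and its iterates. -/

/-- Families of Lipschitz maps between the fibers, with constants `β`. -/
abbrev LipFam {M : Type*} (X Y : M → Type*) [∀ m, MetricSpace (X m)] [∀ m, MetricSpace (Y m)]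
    (β : M → ℝ≥0) : Type _ :=
  {f : ∀ m, X m → Y m // ∀ m, LipschitzWith (β m) (f m)}

/-- Every point of the graph of `g` has a successor on the graph of `f`. -/
def MapsGraph {M : Type*} {Z X Y : M → Type*} {v : M → M} (R : ∀ m, Z m → Z (v m) → Prop)
    (px : ∀ m, Z m → X m) (py : ∀ m, Z m → Y m) (g f : ∀ m, X m → Y m) : Prop :=
  ∀ m z, py m z = g m (px m z) → ∃ z', R m z z' ∧ py (v m) z' = f (v m) (px (v m) z')

namespace Dichotomy

variable {M : Type*} {Z X Y : M → Type*} [∀ m, MetricSpace (Z m)]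
  [∀ m, MetricSpace (X m)] [∀ m, MetricSpace (Y m)] {v : M → M}
  {R : ∀ m, Z m → Z (v m) → Prop} {px : ∀ m, Z m → X m} {py : ∀ m, Z m → Y m}
  {α lu β ls : M → ℝ≥0}

theorem exists_graphTransform [∀ m, CompleteSpace (Y m)] (D : Dichotomy v R px py α lu β ls)
    (y₀ : ∀ m, Y m) :
    ∃ T : LipFam X Y β → LipFam X Y β, ∀ f, MapsGraph R px py (T f).1 f.1 := by
  have key : ∀ f : LipFam X Y β, ∃ g : LipFam X Y β, MapsGraph R px py g.1 f.1 := by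
    intro f
    choose z z' h hx hy using
      fun m => D.exists_step_to_graph m (y₀ (v m)) (f.2 (v m))
    refine ⟨⟨fun m x => py m (z m x), fun m => LipschitzWith.of_dist_le_mul fun x x' => ?_⟩, ?_⟩
    · have := (D.condB_of_graph (h m x) (h m x') (f.2 _) (hy m x) (hy m x')).1
      rwa [hx, hx] at this
    · intro m w hw
      have e : z m (px m w) = w := D.ext (hx m _) hw.symm
      exact ⟨_, e ▸ h m (px m w), hy m _⟩
  choose T hT using key
  exact ⟨T, hT⟩

/-- Monotonicity of `α` along `v` keeps the pair in the cone, so that (A) can be iterated; for (B)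
below, antitonicity of `β` does the same backwards. -/
theorem stepN_condA (D : Dichotomy v R px py α lu β ls) (n : ℕ) :
    ∀ m (z w : Z m) (z' w' : Z (v^[n] m)), stepN R n m z z' → stepN R n m w w' →
      dist (px m z) (px m w) ≤ α m * dist (py m z) (py m w) →
      dist (px _ z') (px _ w') ≤ α (v^[n] m) * dist (py _ z') (py _ w') ∧
      dist (py m z) (py m w) ≤ prodN v lu n m * dist (py _ z') (py _ w') := by
  induction n with
  | zero =>
    rintro m z w z' w' (rfl : z' = z) (rfl : w' = w) h
    exact ⟨h, by simp only [prodN, NNReal.coe_one, one_mul]; exact le_rfl⟩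
  | succ n ih =>
    rintro m z w z' w' ⟨z₁, hz, hz'⟩ ⟨w₁, hw, hw'⟩ h
    obtain ⟨h1, h2⟩ := D.condA m _ _ _ _ hz hw h
    have hm : (α m : ℝ) ≤ α (v m) := D.mono m
    obtain ⟨h3, h4⟩ := ih (v m) z₁ w₁ z' w' hz' hw' (h1.trans (by gcongr))
    refine ⟨h3, h2.trans ?_⟩
    simp only [prodN, NNReal.coe_mul, mul_assoc]
    exact mul_le_mul_of_nonneg_left h4 (NNReal.coe_nonneg _)

theorem stepN_condB (D : Dichotomy v R px py α lu β ls) (n : ℕ) :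
    ∀ m (z w : Z m) (z' w' : Z (v^[n] m)), stepN R n m z z' → stepN R n m w w' →
      dist (py _ z') (py _ w') ≤ β (v^[n] m) * dist (px _ z') (px _ w') →
      dist (py m z) (py m w) ≤ β m * dist (px m z) (px m w) ∧
      dist (px _ z') (px _ w') ≤ prodN v ls n m * dist (px m z) (px m w) := by
  induction n with
  | zero =>
    rintro m z w z' w' (rfl : z' = z) (rfl : w' = w) h
    exact ⟨h, by simp only [prodN, NNReal.coe_one, one_mul]; exact le_rfl⟩
  | succ n ih =>
    rintro m z w z' w' ⟨z₁, hz, hz'⟩ ⟨w₁, hw, hw'⟩ h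
    obtain ⟨h1, h2⟩ := ih (v m) z₁ w₁ z' w' hz' hw' h
    have hm : (β (v m) : ℝ) ≤ β m := D.anti m
    obtain ⟨h3, h4⟩ := D.condB m _ _ _ _ hz hw (h1.trans (by gcongr))
    refine ⟨h3, h2.trans ?_⟩
    simp only [prodN, NNReal.coe_mul]
    rw [mul_comm (ls m : ℝ), mul_assoc]
    exact mul_le_mul_of_nonneg_left h4 (NNReal.coe_nonneg _)

end Dichotomy

theorem stepN_graph {M : Type*} {Z X Y : M → Type*} [∀ m, MetricSpace (X m)]
    [∀ m, MetricSpace (Y m)] {v : M → M} {R : ∀ m, Z m → Z (v m) → Prop} {px : ∀ m, Z m → X m}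
    {py : ∀ m, Z m → Y m} {β : M → ℝ≥0} {T : LipFam X Y β → LipFam X Y β}
    (hT : ∀ f, MapsGraph R px py (T f).1 f.1) (f : LipFam X Y β) (n : ℕ) :
    ∀ m z, py m z = (T^[n] f).1 m (px m z) →
      ∃ z', stepN R n m z z' ∧ py _ z' = f.1 (v^[n] m) (px _ z') := by
  induction n with
  | zero => exact fun m z h => ⟨z, rfl, h⟩
  | succ n ih =>
    intro m z h
    rw [Function.iterate_succ_apply'] at h
    obtain ⟨w, hw, hw'⟩ := hT _ m z h
    obtain ⟨z', hz', h'⟩ := ih (v m) w hw'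
    exact ⟨z', ⟨w, hw, hz'⟩, h'⟩

theorem prodN_le_pow {M : Type*} {v : M → M} {e : M → ℝ≥0} {K : ℝ} (h : ∀ m, (e m : ℝ) ≤ K)
    (n : ℕ) : ∀ m, (prodN v e n m : ℝ) ≤ K ^ n := by
  induction n with
  | zero => simp [prodN]
  | succ n ih =>
    intro m
    rw [prodN, NNReal.coe_mul, pow_succ']
    exact mul_le_mul (h m) (ih _) (NNReal.coe_nonneg _) ((NNReal.coe_nonneg _).trans (h m))

/-- The factor `η` is kept on both sides so that one statement serves two cases: `e ≤ θ`, and `η =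
0` with `e` unrestricted. -/
theorem prodN_mul_le {M : Type*} {v : M → M} {e η : M → ℝ≥0} {θ : ℝ} (hθ : 0 ≤ θ)
    (h : ∀ m, (e m : ℝ) * η m ≤ θ * η m) (hη : ∀ m, η (v m) = η m) (n : ℕ) :
    ∀ m, (prodN v e n m : ℝ) * η m ≤ θ ^ n * η m := by
  induction n with
  | zero => simp [prodN]
  | succ n ih =>
    intro m
    have := ih (v m)
    rw [hη] at this
    calc (prodN v e (n + 1) m : ℝ) * η m = e m * (prodN v e n (v m) * η m) := by
          simp [prodN, mul_assoc]
      _ ≤ e m * (θ ^ n * η m) := by gcongr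
      _ = θ ^ n * (e m * η m) := by ring
      _ ≤ θ ^ n * (θ * η m) := by gcongr ?_ * ?_; exact h m
      _ = θ ^ (n + 1) * η m := by ring

/-! ### Pseudo-invariant sections and the invariant graph near them. -/

/-- The section `i` is pseudo-invariant with errors bounded by `η`: near `i m` and `i (v m)`
there are corresponding points. -/
structure NearInvariant {M : Type*} {Z : M → Type*} [∀ m, MetricSpace (Z m)] {v : M → M}
    (R : ∀ m, Z m → Z (v m) → Prop) (i : ∀ m, Z m) (η : M → ℝ≥0) : Prop where
  invariant : ∀ m, η (v m) = η m
  exists_near : ∀ m, ∃ z z', R m z z' ∧ dist z (i m) ≤ η m ∧ dist z' (i (v m)) ≤ η m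

namespace Dichotomy

variable {M : Type*} {Z X Y : M → Type*} [∀ m, MetricSpace (Z m)]
  [∀ m, MetricSpace (X m)] [∀ m, MetricSpace (Y m)] {v : M → M}
  {R : ∀ m, Z m → Z (v m) → Prop} {px : ∀ m, Z m → X m} {py : ∀ m, Z m → Y m}
  {α lu β ls : M → ℝ≥0} {i : ∀ m, Z m} {η : M → ℝ≥0}

/-- `NearInvariant` only provides some step near the section, a notion that is symmetric under
inversion. This recovers the step prescribed by the generating map, at the cost of a constant factor
in the error. -/
theorem exists_near_generating (D : Dichotomy v R px py α lu β ls) (hi : NearInvariant R i η) :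
    ∃ c : ℝ, 0 ≤ c ∧ ∀ m, ∃ w w', R m w w' ∧ px m w = px m (i m) ∧
      py (v m) w' = py (v m) (i (v m)) ∧ dist (py m w) (py m (i m)) ≤ c * η m ∧
      dist (px (v m) w') (px (v m) (i (v m))) ≤ c * η m := by
  obtain ⟨K, hK, hb⟩ := D.bdd_pos
  refine ⟨2 * K + 1, by positivity, fun m => ?_⟩
  obtain ⟨z, z', h, hz, hz'⟩ := hi.exists_near m
  obtain ⟨w, w', hw, hwx, hwy⟩ := D.gen m (px m (i m)) (py (v m) (i (v m)))
  -- The intermediate step `q` shares its start `px` with `w` and its end `py` with `z`, so (A)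
  -- compares it with the former and (B) with the latter.
  obtain ⟨q, q', hq, hqx, hqy⟩ := D.gen m (px m (i m)) (py (v m) z')
  obtain ⟨b1, b2, b3, b4⟩ := hb m
  refine ⟨w, w', hw, hwx, hwy, ?_, ?_⟩
  · have h1 := (D.condB_of_eq hq h hqy).1
    have h2 := (D.condA_of_eq hw hq (hwx.trans hqx.symm)).2
    rw [hwy, hqy] at h2
    rw [hqx] at h1
    have e1 : dist (px m (i m)) (px m z) ≤ η m := by
      rw [dist_comm]; exact (D.dist_px_le _ _).trans hz
    have e2 : dist (py (v m) (i (v m))) (py (v m) z') ≤ η m := by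
      rw [dist_comm]; exact (D.dist_py_le _ _).trans hz'
    have e3 : dist (py m z) (py m (i m)) ≤ η m := (D.dist_py_le _ _).trans hz
    have h1' : dist (py m q) (py m z) ≤ K * η m := h1.trans (by gcongr)
    have h2' : dist (py m w) (py m q) ≤ K * η m := h2.trans (by gcongr)
    linarith [dist_triangle4 (py m w) (py m q) (py m z) (py m (i m))]
  · have h1 := (D.condB_of_eq hq h hqy).2
    have h2 := (D.condA_of_eq hw hq (hwx.trans hqx.symm)).1
    rw [hwy, hqy] at h2
    rw [hqx] at h1
    have e1 : dist (px m (i m)) (px m z) ≤ η m := by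
      rw [dist_comm]; exact (D.dist_px_le _ _).trans hz
    have e2 : dist (py (v m) (i (v m))) (py (v m) z') ≤ η m := by
      rw [dist_comm]; exact (D.dist_py_le _ _).trans hz'
    have e3 : dist (px (v m) z') (px (v m) (i (v m))) ≤ η m := (D.dist_px_le _ _).trans hz'
    have h1' : dist (px (v m) q') (px (v m) z') ≤ K * η m := h1.trans (by gcongr)
    have h2' : dist (px (v m) w') (px (v m) q') ≤ K * η m := h2.trans (by gcongr)
    linarith [dist_triangle4 (px (v m) w') (px (v m) q') (px (v m) z') (px (v m) (i (v m)))]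

/-- One graph transform step: a graph that is near the section at `v m` is met from above
`px (i m)` near the section. -/
theorem exists_near_step (D : Dichotomy v R px py α lu β ls) (hi : NearInvariant R i η)
    {E : ℝ} (hE : 0 ≤ E) :
    ∃ E' : ℝ, 0 ≤ E' ∧ ∀ m (f : X (v m) → Y (v m)), LipschitzWith (β (v m)) f →
      dist (f (px (v m) (i (v m)))) (py (v m) (i (v m))) ≤ E * η m →
      ∀ z z', R m z z' → px m z = px m (i m) → py (v m) z' = f (px (v m) z') →
      dist (py m z) (py m (i m)) ≤ E' * η m ∧
      dist (px (v m) z') (px (v m) (i (v m))) ≤ E' * η m := by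
  obtain ⟨K, hK, hb⟩ := D.bdd_pos
  obtain ⟨θ, h0, h1, _, hang⟩ := D.angle_step
  obtain ⟨c, hc, hw⟩ := D.exists_near_generating hi
  -- With `dx` and `dy` the two end distances, `dx ≤ α dy + c η` and `dy ≤ β dx + E η`. Substituting
  -- and absorbing `α β dy` gives `dy ≤ A η`.
  set A := (E + K * c) / (1 - θ) with hA
  have h1' : 0 < 1 - θ := by linarith
  have hA0 : 0 ≤ A := by positivity
  refine ⟨K * A + c, by positivity, fun m f hf hfi z z' hz hzx hzy => ?_⟩
  obtain ⟨w, w', hww, hwx, hwy, hw1, hw2⟩ := hw m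
  obtain ⟨b1, b2, b3, b4⟩ := hb m
  obtain ⟨a1, a2⟩ := D.condA_of_eq hz hww (hzx.trans hwx.symm)
  rw [hwy] at a1 a2
  set dy := dist (py (v m) z') (py (v m) (i (v m))) with hdy
  set dx := dist (px (v m) z') (px (v m) (i (v m))) with hdx
  have hη : (0 : ℝ) ≤ η m := NNReal.coe_nonneg _
  have hdy0 : 0 ≤ dy := dist_nonneg
  have e1 : dx ≤ α m * dy + c * η m := by
    linarith [dist_triangle (px (v m) z') (px (v m) w') (px (v m) (i (v m)))]
  have e2 : dy ≤ β (v m) * dx + E * η m := by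
    have t := dist_triangle (py (v m) z') (f (px (v m) (i (v m)))) (py (v m) (i (v m)))
    have t2 := hf.dist_le_mul (px (v m) z') (px (v m) (i (v m)))
    rw [← hzy] at t2
    linarith
  have b3' := (hb (v m)).2.2.1
  have e3 : (1 - θ) * dy ≤ (E + K * c) * η m := by
    have t1 : (β (v m) : ℝ) * dx ≤ β (v m) * (α m * dy + c * η m) := by gcongr
    have t2 : (α m : ℝ) * β (v m) * dy ≤ θ * dy := by gcongr; exact hang m
    have t3 : (β (v m) : ℝ) * (c * η m) ≤ K * (c * η m) := by gcongr
    nlinarith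
  have e4 : dy ≤ A * η m := by
    rw [hA, div_mul_eq_mul_div, le_div_iff₀ h1']; linarith
  constructor
  · have : (lu m : ℝ) * dy ≤ K * (A * η m) := by gcongr
    nlinarith [dist_triangle (py m z) (py m w) (py m (i m))]
  · have : (α m : ℝ) * dy ≤ K * (A * η m) := by gcongr
    nlinarith

end Dichotomy

/-- Weighting the distance by the product of `lu` turns each step into a factor `lu * ls ≤ θ`, while
each of the `n` errors `E' * η` carries the full weight `θ ^ n` by `hlu` and the invariance of `η`.
The growth assumption is needed only for the graphs `T^[k] f` that the orbit passes through. -/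
theorem stepN_graph_growth {M : Type*} {Z X Y : M → Type*} [∀ m, MetricSpace (X m)]
    [∀ m, MetricSpace (Y m)] {v : M → M} {R : ∀ m, Z m → Z (v m) → Prop} {px : ∀ m, Z m → X m}
    {py : ∀ m, Z m → Y m} {lu β ls : M → ℝ≥0} {i : ∀ m, Z m} {η : M → ℝ≥0} {T : LipFam X Y β → LipFam X Y β}
    (hT : ∀ f, MapsGraph R px py (T f).1 f.1) (hη : ∀ m, η (v m) = η m) {θ E' : ℝ} (h0 : 0 ≤ θ)
    (hlu : ∀ m, (lu m : ℝ) * η m ≤ θ * η m) (hspec : ∀ m, (lu m : ℝ) * ls m ≤ θ)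
    (hE' : 0 ≤ E') (n : ℕ) :
    ∀ f : LipFam X Y β, (∀ k < n, ∀ m z z', R m z z' → py _ z' = (T^[k] f).1 (v m) (px _ z') →
      dist (px _ z') (px _ (i (v m))) ≤ ls m * dist (px m z) (px m (i m)) + E' * η m) →
      ∀ m z, py m z = (T^[n] f).1 m (px m z) →
      ∃ z', stepN R n m z z' ∧ py _ z' = f.1 (v^[n] m) (px _ z') ∧
        prodN v lu n m * dist (px _ z') (px _ (i (v^[n] m))) ≤
          θ ^ n * (dist (px m z) (px m (i m)) + n * (E' * η m)) := by
  induction n with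
  | zero =>
    refine fun f _ m z h => ⟨z, rfl, h, ?_⟩
    change _ * dist (px m z) (px m (i m)) ≤ _
    simp [prodN]
  | succ n ih =>
    intro f hf m z hz
    rw [Function.iterate_succ_apply'] at hz
    obtain ⟨w, hw, hwy⟩ := hT _ m z hz
    obtain ⟨z', hz', hzy', hg⟩ := ih f (fun k hk => hf k (by omega)) (v m) w hwy
    refine ⟨z', ⟨w, hw, hz'⟩, hzy', ?_⟩
    rw [hη] at hg
    have h1 := hf n (by omega) m z w hw hwy
    have hη0 : (0 : ℝ) ≤ η m := NNReal.coe_nonneg _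
    calc (prodN v lu (n + 1) m : ℝ) * dist (px _ z') (px _ (i (v^[n + 1] m)))
        = lu m * (prodN v lu n (v m) * dist (px _ z') (px _ (i (v^[n] (v m))))) := by
          rw [prodN, NNReal.coe_mul, mul_assoc]; rfl
      _ ≤ lu m * (θ ^ n * ((ls m * dist (px m z) (px m (i m)) + E' * η m) + n * (E' * η m))) := by
          refine mul_le_mul_of_nonneg_left (hg.trans ?_) (NNReal.coe_nonneg _)
          gcongr
      _ = θ ^ n * ((lu m * ls m) * dist (px m z) (px m (i m))
            + (n + 1) * E' * (lu m * η m)) := by ring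
      _ ≤ θ ^ n * (θ * dist (px m z) (px m (i m)) + (n + 1) * E' * (θ * η m)) := by
          gcongr ?_ * (?_ * _ + _ * ?_)
          · exact hspec m
          · exact hlu m
      _ = θ ^ (n + 1) * (dist (px m z) (px m (i m)) + (n + 1 : ℕ) * (E' * η m)) := by
          push_cast; ring

namespace Dichotomy

variable {M : Type*} {Z X Y : M → Type*} [∀ m, MetricSpace (Z m)]
  [∀ m, MetricSpace (X m)] [∀ m, MetricSpace (Y m)] {v : M → M}
  {R : ∀ m, Z m → Z (v m) → Prop} {px : ∀ m, Z m → X m} {py : ∀ m, Z m → Y m}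
  {α lu β ls : M → ℝ≥0} {i : ∀ m, Z m} {η : M → ℝ≥0}

/-- The constant family through the section. -/
def sectionFam (X : M → Type*) [∀ m, MetricSpace (X m)] (β : M → ℝ≥0) (py : ∀ m, Z m → Y m)
    (i : ∀ m, Z m) : LipFam X Y β :=
  ⟨fun m _ => py m (i m), fun m => (LipschitzWith.const (py m (i m))).weaken zero_le⟩

/-- The constant depends on `n`, since a deviation may be stretched by `K` at every step. It is
needed for finitely many `n` only; `exists_uniform_near` removes the dependence. -/
theorem near_transform_iterate (D : Dichotomy v R px py α lu β ls) (hi : NearInvariant R i η)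
    {T : LipFam X Y β → LipFam X Y β} (hT : ∀ f, MapsGraph R px py (T f).1 f.1) (n : ℕ) :
    ∃ E : ℝ, 0 ≤ E ∧ ∀ m z, px m z = px m (i m) →
      py m z = (T^[n] (sectionFam X β py i)).1 m (px m z) →
      dist (py m z) (py m (i m)) ≤ E * η m ∧ ∃ z' : Z (v^[n] m), stepN R n m z z' ∧
        py _ z' = py _ (i (v^[n] m)) ∧ dist (px _ z') (px _ (i (v^[n] m))) ≤ E * η m := by
  induction n with
  | zero =>
    refine ⟨0, le_rfl, fun m z hx hy => ?_⟩
    have hy' : py m z = py m (i m) := hy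
    refine ⟨by simp [hy'], z, rfl, hy', ?_⟩
    have : px m z = px m (i m) := hx
    change dist (px m z) (px m (i m)) ≤ _
    simp [this]
  | succ n ih =>
    obtain ⟨E, hE, ih⟩ := ih
    obtain ⟨E', hE', hE2⟩ := D.exists_near_step hi hE
    obtain ⟨K, hK, hb⟩ := D.bdd_pos
    have hp := prodN_le_pow (v := v) (fun m => (hb m).2.2.2) n
    refine ⟨E' + (K ^ n * E' + E), by positivity, fun m z hx hy => ?_⟩
    rw [Function.iterate_succ_apply'] at hy
    obtain ⟨w, hw, hwy⟩ := hT _ m z hy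
    -- `w` is near the section but not above it, so the induction hypothesis is applied to the graph
    -- point `q` above it. Both orbits end with the `py` of the section, and the `n`-step (B)
    -- compares them.
    obtain ⟨q, hqx, hqy⟩ := D.exists_mk (v m) (px _ (i (v m)))
      ((T^[n] (sectionFam X β py i)).1 (v m) (px _ (i (v m))))
    obtain ⟨hq1, q', hqq', hqy', hqx'⟩ := ih (v m) q hqx (by rw [hqy, hqx])
    rw [hi.invariant] at hq1 hqx'
    obtain ⟨n1, n2⟩ := hE2 m _ ((T^[n] (sectionFam X β py i)).2 (v m)) (by rwa [← hqy]) z w hw hx hwy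
    obtain ⟨z', hz', hzy'⟩ := stepN_graph hT _ n (v m) w hwy
    have hη : (0 : ℝ) ≤ η m := NNReal.coe_nonneg _
    have hzy'' : py _ z' = py _ (i (v^[n] (v m))) := hzy'
    obtain ⟨-, b⟩ := D.stepN_condB n (v m) w q z' q' hz' hqq'
      (by rw [hzy'', hqy', dist_self]; positivity)
    rw [hqx] at b
    have b' : dist (px _ z') (px _ q') ≤ K ^ n * (E' * η m) :=
      b.trans (mul_le_mul (hp _) n2 dist_nonneg (by positivity))
    refine ⟨n1.trans ?_, z', ⟨w, hw, hz'⟩, hzy'', ?_⟩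
    · gcongr
      have : 0 ≤ K ^ n * E' + E := by positivity
      linarith
    · have t : dist (px _ z') (px _ (i (v^[n] (v m)))) ≤ _ := dist_triangle _ (px _ q') _
      refine t.trans ?_
      have : 0 ≤ E' * η m := by positivity
      linarith

/-- The iterated graph transforms stay near a pseudo-invariant section. -/
theorem exists_uniform_near (D : Dichotomy v R px py α lu β ls) (hi : NearInvariant R i η)
    {T : LipFam X Y β → LipFam X Y β} (hT : ∀ f, MapsGraph R px py (T f).1 f.1)
    {θ : ℝ} (h0 : 0 ≤ θ) (h1 : θ < 1) (hlu : ∀ m, (lu m : ℝ) * η m ≤ θ * η m) :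
    ∃ E : ℝ, 0 ≤ E ∧ ∀ n m, dist ((T^[n] (sectionFam X β py i)).1 m (px m (i m)))
      (py m (i m)) ≤ E * η m := by
  choose C hC0 hC using D.near_transform_iterate hi hT
  obtain ⟨φ, p0, p1, hang, -⟩ := D.angle_step
  obtain ⟨K, hK, hb⟩ := D.bdd_pos
  have h1' : 0 < 1 - φ := by linarith
  -- So many steps are taken at once that the contraction `θ ^ (N + 1)` beats the factor `1 / (1 -
  -- φ)` lost to the angle and leaves a factor `1 / 2`.
  obtain ⟨N, hN⟩ := exists_pow_lt_of_lt_one (show 0 < (1 - φ) / 2 by positivity) h1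
  have hN' : θ ^ (N + 1) ≤ (1 - φ) / 2 := by
    rw [pow_succ]; nlinarith [pow_nonneg h0 N]
  -- The sum covers the iterates up to `N`. The second term makes `C + (K C + E) / 2 ≤ E` with `C =
  -- C (N + 1)`, which closes the induction.
  set E := ∑ n ∈ Finset.range (N + 1), C n + (2 + K) * C (N + 1) with hEdef
  have hs : 0 ≤ ∑ n ∈ Finset.range (N + 1), C n := Finset.sum_nonneg fun n _ => hC0 n
  have hcN := hC0 (N + 1)
  refine ⟨E, by positivity, fun n => ?_⟩
  induction n using Nat.strong_induction_on with
  | _ n ih =>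
  intro m
  have hη : (0 : ℝ) ≤ η m := NNReal.coe_nonneg _
  by_cases hn : n < N + 1
  · obtain ⟨z, hx, hy⟩ := D.exists_mk m (px m (i m))
      ((T^[n] (sectionFam X β py i)).1 m (px m (i m)))
    obtain ⟨h, -⟩ := hC n m z hx (by rw [hy, hx])
    rw [hy] at h
    refine h.trans ?_
    gcongr
    have : C n ≤ ∑ n ∈ Finset.range (N + 1), C n :=
      Finset.single_le_sum (fun n _ => hC0 n) (Finset.mem_range.2 hn)
    have : 0 ≤ (2 + K) * C (N + 1) := by positivity
    linarith
  · obtain ⟨k, rfl⟩ : ∃ k, n = N + 1 + k := ⟨n - (N + 1), by omega⟩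
    rw [Function.iterate_add_apply]
    set f₀ := sectionFam X β py i with hf₀
    set f := T^[k] f₀ with hf
    obtain ⟨z, hx, hy⟩ := D.exists_mk m (px m (i m)) ((T^[N + 1] f).1 m (px m (i m)))
    -- The reference orbit `w` uses the transform of the constant family: its distance to the
    -- section is controlled by `C (N + 1)`, and (A) over `N + 1` steps compares it with `z`.
    obtain ⟨w, hwx, hwy⟩ := D.exists_mk m (px m (i m)) ((T^[N + 1] f₀).1 m (px m (i m)))
    obtain ⟨z', hz', hzy'⟩ := stepN_graph hT f (N + 1) m z (by rw [hy, hx])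
    obtain ⟨w1, w', hw', hwy', hwx'⟩ := hC (N + 1) m w hwx (by rw [hwy, hwx])
    obtain ⟨a1, a2⟩ := D.stepN_condA (N + 1) m z w z' w' hz' hw'
      (by rw [hx, hwx, dist_self]; positivity)
    have hk := ih k (by omega) (v^[N + 1] m)
    have hηN : η (v^[N + 1] m) = η m := by
      generalize N + 1 = j
      clear * - hi
      induction j generalizing m with
      | zero => rfl
      | succ j ihj => exact (ihj (v m)).trans (hi.invariant m)
    rw [hηN] at hk
    rw [← hy]
    set d := dist (py (v^[N + 1] m) z') (py (v^[N + 1] m) w') with hd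
    have hd0 : 0 ≤ d := dist_nonneg
    have e1 : d ≤ β (v^[N + 1] m) * dist (px (v^[N + 1] m) z') (px (v^[N + 1] m) w') + β (v^[N + 1] m) * (C (N + 1) * η m) + E * η m := by
      have t := dist_triangle4 (py (v^[N + 1] m) z') (f.1 (v^[N + 1] m) (px (v^[N + 1] m) w')) (f.1 (v^[N + 1] m) (px (v^[N + 1] m) (i (v^[N + 1] m)))) (py (v^[N + 1] m) w')
      have t1 := (f.2 (v^[N + 1] m)).dist_le_mul (px (v^[N + 1] m) z') (px (v^[N + 1] m) w')
      have t2 := (f.2 (v^[N + 1] m)).dist_le_mul (px (v^[N + 1] m) w') (px (v^[N + 1] m) (i (v^[N + 1] m)))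
      rw [← hzy'] at t1
      have t4 : dist (f.1 (v^[N + 1] m) (px (v^[N + 1] m) (i (v^[N + 1] m))))
          (py (v^[N + 1] m) w') ≤ E * η m := by rw [hwy']; exact hk
      have t3 : (β (v^[N + 1] m) : ℝ) * dist (px (v^[N + 1] m) w') (px (v^[N + 1] m) (i (v^[N + 1] m))) ≤ β (v^[N + 1] m) * (C (N + 1) * η m) := by
        gcongr
      linarith
    have e2 : (1 - φ) * d ≤ (K * C (N + 1) + E) * η m := by
      have t1 : (β (v^[N + 1] m) : ℝ) * dist (px (v^[N + 1] m) z') (px (v^[N + 1] m) w') ≤ β (v^[N + 1] m) * (α (v^[N + 1] m) * d) :=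
        mul_le_mul_of_nonneg_left a1 (NNReal.coe_nonneg _)
      have t2 : (α (v^[N + 1] m) : ℝ) * β (v^[N + 1] m) * d ≤ φ * d := by gcongr; exact hang (v^[N + 1] m)
      have t3 : (β (v^[N + 1] m) : ℝ) * (C (N + 1) * η m) ≤ K * (C (N + 1) * η m) := by
        gcongr; exact (hb (v^[N + 1] m)).2.2.1
      nlinarith
    have e3 : (prodN v lu (N + 1) m : ℝ) * d ≤ (K * C (N + 1) + E) / 2 * η m := by
      have hp := prodN_mul_le h0 hlu hi.invariant (N + 1) m
      have e4 : d ≤ (K * C (N + 1) + E) / (1 - φ) * η m := by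
        rw [div_mul_eq_mul_div, le_div_iff₀ h1']; linarith
      have hQ : 0 ≤ (K * C (N + 1) + E) / (1 - φ) := by positivity
      calc (prodN v lu (N + 1) m : ℝ) * d
          ≤ prodN v lu (N + 1) m * ((K * C (N + 1) + E) / (1 - φ) * η m) := by gcongr
        _ = (K * C (N + 1) + E) / (1 - φ) * (prodN v lu (N + 1) m * η m) := by ring
        _ ≤ (K * C (N + 1) + E) / (1 - φ) * ((1 - φ) / 2 * η m) := by
            refine mul_le_mul_of_nonneg_left (hp.trans ?_) hQ
            gcongr
        _ = (K * C (N + 1) + E) / 2 * η m := by field_simp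
    have t := dist_triangle (py m z) (py m w) (py m (i m))
    have : C (N + 1) * η m + (K * C (N + 1) + E) / 2 * η m ≤ E * η m := by
      rw [← add_mul]; gcongr; linarith
    exact (t.trans (add_le_add (a2.trans e3) w1)).trans (by linarith)

/-- Along a graph near the section, the distance to the section grows at most like `ls`. -/
theorem exists_graph_growth (D : Dichotomy v R px py α lu β ls) (hi : NearInvariant R i η)
    {E : ℝ} (hE : 0 ≤ E) :
    ∃ E' : ℝ, 0 ≤ E' ∧ ∀ f g : LipFam X Y β, MapsGraph R px py g.1 f.1 →
      (∀ m, dist (f.1 m (px m (i m))) (py m (i m)) ≤ E * η m) →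
      ∀ m z z', R m z z' → py _ z' = f.1 (v m) (px _ z') →
      dist (px _ z') (px _ (i (v m))) ≤ ls m * dist (px m z) (px m (i m)) + E' * η m := by
  obtain ⟨E', hE', hE2⟩ := D.exists_near_step hi hE
  refine ⟨E', hE', fun f g hfg hf m z z' hz hz' => ?_⟩
  obtain ⟨q, hqx, hqy⟩ := D.exists_mk m (px m (i m)) (g.1 m (px m (i m)))
  obtain ⟨q', hq, hq'⟩ := hfg m q (by rw [hqy, hqx])
  have hfv := hf (v m)
  rw [hi.invariant] at hfv
  have h1 := (hE2 m _ (f.2 (v m)) hfv q q' hq hqx hq').2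
  have h2 := (D.condB_of_graph hz hq (f.2 _) hz' hq').2
  rw [hqx] at h2
  linarith [dist_triangle (px _ z') (px _ q') (px _ (i (v m)))]

/-- The stable graph through a pseudo-invariant section. -/
theorem exists_graph [∀ m, CompleteSpace (Y m)] (D : Dichotomy v R px py α lu β ls)
    (hi : NearInvariant R i η) {θ : ℝ} (h1 : θ < 1)
    (hlu : ∀ m, (lu m : ℝ) * η m ≤ θ * η m) :
    ∃ f : LipFam X Y β, MapsGraph R px py f.1 f.1 ∧ ∃ E : ℝ, 0 ≤ E ∧
      (∀ m, dist (f.1 m (px m (i m))) (py m (i m)) ≤ E * η m) ∧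
      ∀ m z z', R m z z' → py _ z' = f.1 (v m) (px _ z') →
        dist (px _ z') (px _ (i (v m))) ≤ ls m * dist (px m z) (px m (i m)) + E * η m := by
  obtain ⟨T, hT⟩ := D.exists_graphTransform (fun m => py m (i m))
  obtain ⟨θs, hs0, hs1, hspec⟩ := D.spec.exists_pos
  obtain ⟨φ, p0, p1, hang, -⟩ := D.angle_step
  obtain ⟨K, hK, hb⟩ := D.bdd_pos
  have h1' : 0 < 1 - φ := by linarith
  set ϑ := max θs θ with hϑ
  have t0 : 0 ≤ ϑ := hs0.le.trans (le_max_left _ _)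
  have t1 : ϑ < 1 := max_lt hs1 h1
  have hlu' : ∀ m, (lu m : ℝ) * η m ≤ ϑ * η m := fun m =>
    (hlu m).trans (by gcongr; exact le_max_right _ _)
  have hspec' : ∀ m, (lu m : ℝ) * ls m ≤ ϑ := fun m => (hspec m).trans (le_max_left _ _)
  obtain ⟨E, hE, hnear⟩ := D.exists_uniform_near hi hT t0 t1 hlu'
  obtain ⟨E', hE', hgrow⟩ := D.exists_graph_growth hi hE
  set f₀ := sectionFam X β py i with hf₀
  -- Since `T^[n + 1] f₀ = T^[n] (T f₀)`, both points over `x` have `n`-step orbits, ending on the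
  -- graphs of `f₀` and `T f₀`. The bound depends on `x`, so convergence is only pointwise.
  have hstep : ∀ n m x, dist ((T^[n] f₀).1 m x) ((T^[n + 1] f₀).1 m x) ≤
      (K * dist x (px m (i m)) + E * η m) / (1 - φ) * ϑ ^ n
        + K * E' * η m / (1 - φ) * ((n : ℝ) ^ 1 * ϑ ^ n) := by
    intro n m x
    obtain ⟨z, hx, hy⟩ := D.exists_mk m x ((T^[n] f₀).1 m x)
    obtain ⟨w, hwx, hwy⟩ := D.exists_mk m x ((T^[n + 1] f₀).1 m x)
    obtain ⟨z', hz', hzy'⟩ := stepN_graph hT f₀ n m z (by rw [hy, hx])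
    obtain ⟨w', hw', hwy', hw⟩ := stepN_graph_growth (i := i) (η := η) (ls := ls) hT hi.invariant
      t0 hlu' hspec' hE' n (T f₀) (fun k _ m z z' hz hz' => hgrow (T^[k + 1] f₀) (T^[k + 1 + 1] f₀)
        (by rw [Function.iterate_succ_apply' T (k + 1)]; exact hT _) (hnear _) m z z' hz hz')
      m w (by rw [hwy, hwx]; rfl)
    obtain ⟨a1, a2⟩ := D.stepN_condA n m z w z' w' hz' hw'
      (by rw [hx, hwx, dist_self]; positivity)
    rw [hy, hwy] at a2
    rw [hwx] at hw
    have hk := hnear 1 (v^[n] m)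
    have hηn : η (v^[n] m) = η m := by
      clear * - hi
      induction n generalizing m with
      | zero => rfl
      | succ j ihj => exact (ihj (v m)).trans (hi.invariant m)
    rw [hηn] at hk
    have hη0 : (0 : ℝ) ≤ η m := NNReal.coe_nonneg _
    have hzy'' : py (v^[n] m) z' = py (v^[n] m) (i (v^[n] m)) := hzy'
    have e1 : dist (py (v^[n] m) z') (py (v^[n] m) w') ≤ K * dist (px (v^[n] m) w') (px (v^[n] m) (i (v^[n] m))) + E * η m := by
      rw [hzy'', hwy', dist_comm]
      have t := dist_triangle ((T f₀).1 (v^[n] m) (px (v^[n] m) w')) ((T f₀).1 (v^[n] m) (px (v^[n] m) (i (v^[n] m)))) (py (v^[n] m) (i (v^[n] m)))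
      have t2 := ((T f₀).2 (v^[n] m)).dist_le_mul (px (v^[n] m) w') (px (v^[n] m) (i (v^[n] m)))
      have t3 : (β (v^[n] m) : ℝ) * dist (px (v^[n] m) w') (px (v^[n] m) (i (v^[n] m))) ≤
          K * dist (px (v^[n] m) w') (px (v^[n] m) (i (v^[n] m))) := by gcongr; exact (hb (v^[n] m)).2.2.1
      exact (t.trans (add_le_add t2 hk)).trans (by linarith)
    -- The factor `1 / (1 - φ)` in `hstep` is slack: as `f₀` is constant, the end points are
    -- compared without using the angle.
    have hφ1 : 1 ≤ 1 / (1 - φ) := by rw [le_div_iff₀ h1']; linarith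
    have e2 : (prodN v lu n m : ℝ) * dist (py (v^[n] m) z') (py (v^[n] m) w') ≤
        (K * dist x (px m (i m)) + E * η m) * ϑ ^ n + K * E' * η m * ((n : ℝ) ^ 1 * ϑ ^ n) := by
      calc (prodN v lu n m : ℝ) * dist (py (v^[n] m) z') (py (v^[n] m) w')
          ≤ prodN v lu n m * (K * dist (px (v^[n] m) w') (px (v^[n] m) (i (v^[n] m))) + E * η m) := by gcongr
        _ = K * (prodN v lu n m * dist (px (v^[n] m) w') (px (v^[n] m) (i (v^[n] m))))
            + E * (prodN v lu n m * η m) := by ring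
        _ ≤ K * (ϑ ^ n * (dist x (px m (i m)) + n * (E' * η m))) + E * (ϑ ^ n * η m) := by
            refine add_le_add (mul_le_mul_of_nonneg_left hw hK.le)
              (mul_le_mul_of_nonneg_left (prodN_mul_le t0 hlu' hi.invariant n m) hE)
        _ = _ := by ring
    have e3 : 0 ≤ (K * dist x (px m (i m)) + E * η m) * ϑ ^ n
        + K * E' * η m * ((n : ℝ) ^ 1 * ϑ ^ n) := by positivity
    calc _ ≤ _ := a2.trans e2
      _ ≤ ((K * dist x (px m (i m)) + E * η m) * ϑ ^ n
        + K * E' * η m * ((n : ℝ) ^ 1 * ϑ ^ n)) * (1 / (1 - φ)) := le_mul_of_one_le_right e3 hφ1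
      _ = _ := by ring
  have hcauchy : ∀ m x, CauchySeq fun n => (T^[n] f₀).1 m x := by
    intro m x
    refine cauchySeq_of_summable_dist (Summable.of_nonneg_of_le (fun _ => dist_nonneg)
      (fun n => hstep n m x) ?_)
    have s1 : Summable fun n : ℕ => ϑ ^ n := summable_geometric_of_lt_one t0 t1
    have s2 : Summable fun n : ℕ => (n : ℝ) ^ 1 * ϑ ^ n :=
      summable_pow_mul_geometric_of_norm_lt_one 1 (by rwa [Real.norm_of_nonneg t0])
    exact (s1.mul_left _).add (s2.mul_left _)
  choose F hF using fun m x => cauchySeq_tendsto_of_complete (hcauchy m x)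
  let f : LipFam X Y β := ⟨F, fun m => LipschitzWith.of_dist_le_mul fun x x' =>
    le_of_tendsto ((hF m x).dist (hF m x')) (Eventually.of_forall fun n =>
      ((T^[n] f₀).2 m).dist_le_mul x x')⟩
  have hfE : ∀ m, dist (f.1 m (px m (i m))) (py m (i m)) ≤ E * η m := fun m =>
    le_of_tendsto ((hF m _).dist tendsto_const_nhds) (Eventually.of_forall fun n => hnear n m)
  -- Pointwise convergence suffices: the value of `T f` at `x` is compared with the iterates through
  -- the single point `px z'` over `v m`, and the angle absorbs the displacement of the end points.
  have hfix : ∀ m x, (T f).1 m x = f.1 m x := by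
    intro m x
    obtain ⟨z, hx, hy⟩ := D.exists_mk m x ((T f).1 m x)
    obtain ⟨z', hz, hz'⟩ := hT f m z (by rw [hy, hx])
    have hle : ∀ n, dist ((T^[n + 1] f₀).1 m x) ((T f).1 m x) ≤
        K * (dist ((T^[n] f₀).1 (v m) (px _ z')) (f.1 (v m) (px _ z')) / (1 - φ)) := by
      intro n
      obtain ⟨w, hwx, hwy⟩ := D.exists_mk m x ((T^[n + 1] f₀).1 m x)
      have hwy2 : py m w = (T (T^[n] f₀)).1 m (px m w) := by
        rw [hwy, hwx, Function.iterate_succ_apply']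
      obtain ⟨w', hw, hw'⟩ := hT _ m w hwy2
      obtain ⟨a1, a2⟩ := D.condA_of_eq hw hz (hwx.trans hx.symm)
      rw [hwy, hy] at a2
      set d := dist (py _ w') (py _ z') with hd
      have hd0 : 0 ≤ d := dist_nonneg
      set ε := dist ((T^[n] f₀).1 (v m) (px _ z')) (f.1 (v m) (px _ z')) with hε
      have e1 : d ≤ β (v m) * (α m * d) + ε := by
        have t := dist_triangle (py _ w') ((T^[n] f₀).1 (v m) (px _ z')) (py _ z')
        have t2 := ((T^[n] f₀).2 (v m)).dist_le_mul (px _ w') (px _ z')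
        rw [← hw'] at t2
        have t4 : dist ((T^[n] f₀).1 (v m) (px _ z')) (py _ z') = ε := by rw [hz']
        have t3 : (β (v m) : ℝ) * dist (px _ w') (px _ z') ≤ β (v m) * (α m * d) := by gcongr
        linarith
      have e2 : (α m : ℝ) * β (v m) ≤ φ := by
        refine le_trans ?_ (hang m)
        gcongr
        exact D.anti m
      have e3 : d ≤ ε / (1 - φ) := by
        rw [le_div_iff₀ h1']; nlinarith
      refine a2.trans ?_
      gcongr
      exact (hb m).2.1
    have hlim : Tendsto (fun n => K * (dist ((T^[n] f₀).1 (v m) (px _ z')) (f.1 (v m) (px _ z'))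
        / (1 - φ))) atTop (𝓝 0) := by
      have := ((tendsto_iff_dist_tendsto_zero.1 (hF (v m) (px _ z'))).div_const (1 - φ)).const_mul K
      simpa using this
    have hl2 : Tendsto (fun n => (T^[n + 1] f₀).1 m x) atTop (𝓝 ((T f).1 m x)) :=
      tendsto_iff_dist_tendsto_zero.2 (squeeze_zero (fun _ => dist_nonneg) hle hlim)
    exact tendsto_nhds_unique hl2 ((tendsto_add_atTop_iff_nat 1).2 (hF m x))
  have hinv : MapsGraph R px py f.1 f.1 := by
    intro m z hz
    exact hT f m z (by rw [hfix]; exact hz)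
  refine ⟨f, hinv, max E E', le_max_of_le_left hE, fun m => (hfE m).trans ?_,
    fun m z z' hz hz' => (hgrow f f hinv hfE m z z' hz hz').trans ?_⟩
  · gcongr; exact le_max_left _ _
  · gcongr; exact le_max_right _ _

end Dichotomy
-- Orbits, cocycles and growth rates.
/-- An orbit of the correspondence `R` over the map `v`, starting over `m`. -/
def IsOrbit {M : Type*} {Z : M → Type*} {v : M → M} (R : ∀ m, Z m → Z (v m) → Prop) (m : M)
    (z : ∀ k, Z (baseOrbit v m k)) : Prop :=
  ∀ k, R (baseOrbit v m k) (z k) (z (k + 1))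

theorem baseOrbit_succ' {M : Type*} (v : M → M) (m : M) (k : ℕ) :
    baseOrbit v (v m) k = baseOrbit v m (k + 1) := by
  induction k with
  | zero => rfl
  | succ k ih => exact congrArg v ih

theorem cocycle_succ {M : Type*} (v : M → M) (e : M → ℝ) (m : M) (k : ℕ) :
    cocycle v e m (k + 1) = cocycle v e m k * e (baseOrbit v m k) :=
  Finset.prod_range_succ _ _

theorem cocycle_succ' {M : Type*} (v : M → M) (e : M → ℝ) (m : M) (k : ℕ) :
    cocycle v e m (k + 1) = cocycle v e (v m) k * e m := by
  simp only [cocycle, Finset.prod_range_succ', baseOrbit_succ']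
  rfl

theorem cocycle_pos {M : Type*} {v : M → M} {e : M → ℝ} (he : ∀ m, 0 < e m) (m : M) (k : ℕ) :
    0 < cocycle v e m k :=
  Finset.prod_pos fun _ _ => he _

theorem cocycle_nonneg {M : Type*} {v : M → M} {e : M → ℝ} (he : ∀ m, 0 ≤ e m) (m : M) (k : ℕ) :
    0 ≤ cocycle v e m k :=
  Finset.prod_nonneg fun _ _ => he _

theorem cocycle_mul_le_pow {M : Type*} {v : M → M} {e l : M → ℝ} {θ : ℝ} (he : ∀ m, 0 ≤ e m)
    (hl : ∀ m, 0 ≤ l m) (h : ∀ m, l m * e m ≤ θ) (m : M) (k : ℕ) :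
    cocycle v l m k * cocycle v e m k ≤ θ ^ k := by
  rw [cocycle, cocycle, ← Finset.prod_mul_distrib]
  calc _ ≤ ∏ _j ∈ Finset.range k, θ :=
        Finset.prod_le_prod (fun j _ => mul_nonneg (hl _) (he _)) fun j _ => h _
    _ = θ ^ k := by simp

/-- `a ≲ b` for positive `b`, with an explicit constant. -/
theorem dominated_iff {a b : ℕ → ℝ} (hb : ∀ k, 0 < b k) :
    Dominated a b ↔ ∃ C, ∀ k, a k ≤ C * b k := by
  constructor
  · rintro ⟨C, hC⟩
    refine ⟨C, fun k => ?_⟩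
    have := hC ⟨k, rfl⟩
    simp only at this
    rwa [inv_mul_le_iff₀ (hb k), mul_comm] at this
  · rintro ⟨C, hC⟩
    refine ⟨C, ?_⟩
    rintro _ ⟨k, rfl⟩
    simp only
    rw [inv_mul_le_iff₀ (hb k), mul_comm]
    exact hC k

/-- The cocycle of `e` dominates the one of `lo`, and `hi * e` contracts. -/
structure IsRate {M : Type*} (v : M → M) (lo hi : M → ℝ≥0) (e : M → ℝ) : Prop where
  pos : ∀ m, 0 < e m
  exists_le : ∀ m, ∃ C, ∀ k, cocycle v (fun m => (lo m : ℝ)) m k ≤ C * cocycle v e m k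
  tendsto : ∀ m,
    Tendsto (fun k => cocycle v (fun m => (hi m : ℝ)) m k * cocycle v e m k) atTop (𝓝 0)

/-- Sequences that grow at most like `lo` up to bounded errors are dominated by the cocycle
of `e`. -/
def AbsorbsErrors {M : Type*} (v : M → M) (lo : M → ℝ≥0) (e : M → ℝ) : Prop :=
  ∀ m (a : ℕ → ℝ) (c : ℝ), (∀ k, 0 ≤ a k) → 0 ≤ c →
    (∀ k, a (k + 1) ≤ lo (baseOrbit v m k) * a k + c) → ∃ C, ∀ k, a k ≤ C * cocycle v e m k

section Rates

variable {M : Type*} {v : M → M} {lo hi : M → ℝ≥0} {ς : ℝ} {e : M → ℝ}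

theorem AdmissibleRate.pos (h : AdmissibleRate lo hi ς e) (hς : 0 < ς) (m : M) : 0 < e m := by
  have := h.1 m
  have : (0 : ℝ) ≤ lo m := NNReal.coe_nonneg _
  linarith

theorem AdmissibleRate.isRate (h : AdmissibleRate lo hi ς e) (hς : 0 < ς) :
    IsRate v lo hi e := by
  obtain ⟨θ, h0, h1, hθ⟩ := h.2.exists_pos
  have hp := h.pos hς
  refine ⟨hp, fun m => ⟨1, fun k => ?_⟩, fun m => ?_⟩
  · rw [one_mul]
    exact Finset.prod_le_prod (fun _ _ => NNReal.coe_nonneg _) fun j _ => by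
      linarith [h.1 (baseOrbit v m j)]
  · exact squeeze_zero (fun k => mul_nonneg (cocycle_nonneg (fun _ => NNReal.coe_nonneg _) _ _)
      (cocycle_pos hp _ _).le) (cocycle_mul_le_pow (fun m => (hp m).le)
      (fun m => NNReal.coe_nonneg _) hθ m) (tendsto_pow_atTop_nhds_zero_of_lt_one h0.le h1)

/-- Needed for dual dichotomies, whose constants are composed with `u.symm` while the rates are
compared with the original constants. The two cocycles are offset by one index, and the boundary
factors are bounded for each fixed `m`. -/
theorem AdmissibleRate.isRate_shift (h : AdmissibleRate lo hi ς e) (hς : 0 < ς) {K : ℝ}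
    (hlo : ∀ m, (lo m : ℝ) ≤ K) (hhi : ∀ m, (hi m : ℝ) ≤ K) :
    IsRate v (lo ∘ v) (hi ∘ v) e := by
  obtain ⟨θ, h0, h1, hθ⟩ := h.2.exists_pos
  have hp := h.pos hς
  have key : ∀ (l : M → ℝ≥0) m k, cocycle v (fun m => ((l ∘ v) m : ℝ)) m k =
      cocycle v (fun m => (l m : ℝ)) (v m) k := by
    intro l m k
    simp only [cocycle, baseOrbit_succ', Function.comp]
    rfl
  refine ⟨hp, fun m => ?_, fun m => ?_⟩
  · obtain ⟨C, hC⟩ := (h.isRate (v := v) hς).exists_le (v m)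
    have hK : 0 ≤ K := (NNReal.coe_nonneg _).trans (hlo m)
    refine ⟨max 1 (K / e m), fun k => ?_⟩
    cases k with
    | zero => simp [cocycle]
    | succ k =>
      have e1 : cocycle v (fun m => (lo m : ℝ)) (v m) k ≤ cocycle v e (v m) k :=
        Finset.prod_le_prod (fun _ _ => NNReal.coe_nonneg _) fun j _ => by
          linarith [h.1 (baseOrbit v (v m) j)]
      have e2 := cocycle_pos (v := v) hp (v m) k
      rw [key, cocycle_succ, cocycle_succ' v e]
      calc cocycle v (fun m => (lo m : ℝ)) (v m) k * lo (baseOrbit v (v m) k)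
          ≤ cocycle v e (v m) k * K := by gcongr; exact hlo _
        _ = K / e m * (cocycle v e (v m) k * e m) := by field_simp [(hp m).ne']
        _ ≤ max 1 (K / e m) * (cocycle v e (v m) k * e m) := by
          have := hp m
          gcongr
          exact le_max_right _ _
  · rw [← tendsto_add_atTop_iff_nat 1]
    have hlim : Tendsto (fun k => θ ^ k * (K * e m)) atTop (𝓝 0) := by
      simpa using (tendsto_pow_atTop_nhds_zero_of_lt_one h0.le h1).mul_const (K * e m)
    refine squeeze_zero (fun k => mul_nonneg (cocycle_nonneg (fun _ => NNReal.coe_nonneg _) _ _)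
      (cocycle_pos hp _ _).le) (fun k => ?_) hlim
    have hem := hp m
    have hK : 0 ≤ K := (NNReal.coe_nonneg _).trans (hhi m)
    have e1 := cocycle_mul_le_pow (v := v) (fun m => (hp m).le)
      (fun m => NNReal.coe_nonneg (hi m)) hθ (v m) k
    rw [key, cocycle_succ, cocycle_succ' v e]
    have e2 := cocycle_pos (v := v) hp (v m) k
    have e3 : 0 ≤ cocycle v (fun m => (hi m : ℝ)) (v m) k :=
      cocycle_nonneg (fun _ => NNReal.coe_nonneg _) _ _
    calc _ = (cocycle v (fun m => (hi m : ℝ)) (v m) k * cocycle v e (v m) k) *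
          (hi (baseOrbit v (v m) k) * e m) := by ring
      _ ≤ θ ^ k * (K * e m) := by gcongr; exact hhi _

theorem AdmissibleRate.absorbsErrors (h : AdmissibleRate lo hi ς e) (hς : 0 < ς)
    (h1 : ∀ m, 1 ≤ e m) {K : ℝ} (hlo : ∀ m, (lo m : ℝ) ≤ K) : AbsorbsErrors v lo e := by
  intro m a c ha hc hrec
  have hK : 0 ≤ K := (NNReal.coe_nonneg _).trans (hlo m)
  -- The additive gap `ς` becomes a multiplicative one: `lo ≤ ρ (lo + ς)` holds because `lo ≤ K`.
  set ρ := K / (K + ς) with hρ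
  have hρ1 : 0 < 1 - ρ := by
    rw [hρ, one_sub_div (by positivity)]; simp; positivity
  have hle : ∀ m, (lo m : ℝ) ≤ ρ * e m := by
    intro m
    have e1 : (lo m : ℝ) ≤ ρ * (lo m + ς) := by
      rw [hρ, div_mul_eq_mul_div, le_div_iff₀ (by positivity)]
      nlinarith [hlo m]
    exact e1.trans (by gcongr; exact (h.1 m).le)
  have hE : ∀ k, 1 ≤ cocycle v e m k := fun k => by
    have : (∏ _j ∈ Finset.range k, (1 : ℝ)) ≤ cocycle v e m k :=
      Finset.prod_le_prod (fun _ _ => zero_le_one) fun _ _ => h1 _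
    simpa using this
  have h00 := ha 0
  refine ⟨a 0 + c / (1 - ρ), fun k => ?_⟩
  -- `B` dominates the initial value and satisfies `ρ B + c ≤ B`. The assumption `1 ≤ e` lets the
  -- cocycle absorb the error `c`.
  set B := a 0 + c / (1 - ρ) with hB
  have hB0 : 0 ≤ B := by positivity
  have hcB : ρ * B + c ≤ B := by
    have : (1 - ρ) * B = (1 - ρ) * a 0 + c := by rw [hB]; field_simp
    nlinarith [mul_nonneg hρ1.le h00]
  induction k with
  | zero =>
    simp only [cocycle, Finset.range_zero, Finset.prod_empty, mul_one, hB]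
    have : 0 ≤ c / (1 - ρ) := by positivity
    linarith
  | succ k ih =>
    have hk := hE (k + 1)
    have hk0 := hE k
    calc a (k + 1) ≤ lo (baseOrbit v m k) * a k + c := hrec k
      _ ≤ (ρ * e (baseOrbit v m k)) * (B * cocycle v e m k) + c * cocycle v e m (k + 1) :=
          add_le_add (mul_le_mul (hle _) ih (ha k) ((NNReal.coe_nonneg _).trans (hle _)))
            (le_mul_of_one_le_right hc hk)
      _ = (ρ * B + c) * cocycle v e m (k + 1) := by rw [cocycle_succ]; ring
      _ ≤ B * cocycle v e m (k + 1) := by gcongr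

theorem AdmissibleRate.absorbsErrors_shift (h : AdmissibleRate lo hi ς e) (hς : 0 < ς)
    (h1 : ∀ m, 1 ≤ e m) {K : ℝ} (hlo : ∀ m, (lo m : ℝ) ≤ K) : AbsorbsErrors v (lo ∘ v) e := by
  intro m a c ha hc hrec
  have hK : 0 ≤ K := (NNReal.coe_nonneg _).trans (hlo m)
  have hm : 0 ≤ max c (a 0) := le_max_of_le_left hc
  -- The index shift is undone by prepending the value `0` to the sequence; enlarging `c` to `max c
  -- (a 0)` covers the new first step.
  obtain ⟨C, hC⟩ := h.absorbsErrors (v := v) hς h1 hlo m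
    (fun k => Nat.casesOn k 0 a) (max c (a 0))
    (fun k => by cases k <;> simp [ha]) hm
    (fun k => by
      cases k with
      | zero => simp
      | succ k =>
        exact (hrec k).trans (add_le_add le_rfl (le_max_left _ _)))
  refine ⟨C * K + max c (a 0), fun k => ?_⟩
  have hE : ∀ k, 1 ≤ cocycle v e m k := fun k => by
    have : (∏ _j ∈ Finset.range k, (1 : ℝ)) ≤ cocycle v e m k :=
      Finset.prod_le_prod (fun _ _ => zero_le_one) fun _ _ => h1 _
    simpa using this
  have hC0 : 0 ≤ C := by
    have := hC 0
    simpa [cocycle] using this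
  cases k with
  | zero =>
    have : 0 ≤ C * K := by positivity
    simp only [cocycle, Finset.range_zero, Finset.prod_empty, mul_one]
    linarith [le_max_right c (a 0)]
  | succ k =>
    have h2 : a k ≤ C * cocycle v e m (k + 1) := hC (k + 1)
    have h3 := hE (k + 1)
    calc a (k + 1) ≤ (lo ∘ v) (baseOrbit v m k) * a k + c := hrec k
      _ ≤ K * (C * cocycle v e m (k + 1)) + max c (a 0) * cocycle v e m (k + 1) := by
          refine add_le_add (mul_le_mul (hlo _) h2 (ha k) hK) ?_
          exact (le_max_left _ _).trans (le_mul_of_one_le_right hm h3)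
      _ = _ := by ring

end Rates

theorem exists_orbit_of_invariant {M : Type*} {Z : M → Type*} {v : M → M}
    {R : ∀ m, Z m → Z (v m) → Prop} {m : M} (P : ∀ k, Z (baseOrbit v m k) → Prop)
    (hP : ∀ k (z : Z (baseOrbit v m k)), P k z →
      ∃ z' : Z (baseOrbit v m (k + 1)), R (baseOrbit v m k) z z' ∧ P (k + 1) z')
    (z₀ : Z m) (h₀ : P 0 z₀) : ∃ z, IsOrbit R m z ∧ z 0 = z₀ ∧ ∀ k, P k (z k) := by
  choose s hs hs' using hP
  let o : ∀ k, {z : Z (baseOrbit v m k) // P k z} := fun k =>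
    Nat.rec (motive := fun k => {z : Z (baseOrbit v m k) // P k z}) ⟨z₀, h₀⟩
      (fun k z => ⟨s k z.1 z.2, hs' k z.1 z.2⟩) k
  exact ⟨fun k => (o k).1, fun k => hs k (o k).1 (o k).2, rfl, fun k => (o k).2⟩

theorem exists_graph_orbit {M : Type*} {Z X Y : M → Type*} {v : M → M}
    {R : ∀ m, Z m → Z (v m) → Prop} {px : ∀ m, Z m → X m} {py : ∀ m, Z m → Y m} {f : ∀ m, X m → Y m} (hf : MapsGraph R px py f f) {m : M} {z₀ : Z m}
    (h₀ : py m z₀ = f m (px m z₀)) :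
    ∃ z, IsOrbit R m z ∧ z 0 = z₀ ∧ ∀ k, py _ (z k) = f _ (px _ (z k)) :=
  exists_orbit_of_invariant (fun _ z => py _ z = f _ (px _ z)) (fun _ z hz => hf _ z hz) z₀ h₀

/-! ### Orbits of a dichotomy: uniqueness, characterization of the graph, leaves. -/

namespace Dichotomy

variable {M : Type*} {Z X Y : M → Type*} [∀ m, MetricSpace (Z m)]
  [∀ m, MetricSpace (X m)] [∀ m, MetricSpace (Y m)] {v : M → M}
  {R : ∀ m, Z m → Z (v m) → Prop} {px : ∀ m, Z m → X m} {py : ∀ m, Z m → Y m}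
  {α lu β ls : M → ℝ≥0}

theorem orbit_condA (D : Dichotomy v R px py α lu β ls) {m : M}
    {z w : ∀ k, Z (baseOrbit v m k)} (hz : IsOrbit R m z) (hw : IsOrbit R m w)
    (h : dist (px m (z 0)) (px m (w 0)) ≤ α m * dist (py m (z 0)) (py m (w 0))) (k : ℕ) :
    dist (px _ (z k)) (px _ (w k)) ≤ α (baseOrbit v m k) * dist (py _ (z k)) (py _ (w k)) ∧
      dist (py m (z 0)) (py m (w 0)) ≤
        cocycle v (fun m => (lu m : ℝ)) m k * dist (py _ (z k)) (py _ (w k)) := by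
  induction k with
  | zero => exact ⟨h, by simp only [cocycle, Finset.range_zero, Finset.prod_empty, one_mul]; rfl⟩
  | succ k ih =>
    obtain ⟨h1, h2⟩ := D.condA _ _ _ _ _ (hz k) (hw k) ih.1
    have hm : (α (baseOrbit v m k) : ℝ) ≤ α (v (baseOrbit v m k)) := D.mono _
    refine ⟨h1.trans (mul_le_mul_of_nonneg_right hm dist_nonneg), ih.2.trans ?_⟩
    rw [cocycle_succ, mul_assoc]
    exact mul_le_mul_of_nonneg_left h2 (cocycle_nonneg (fun _ => NNReal.coe_nonneg _) _ _)

/-- The source of all uniqueness statements: orbits with the same initial `px` separate in `py` at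
least like the inverse product of `lu`, so a slower bound `b` forces them to coincide initially. -/
theorem orbit_zero_eq (D : Dichotomy v R px py α lu β ls) {m : M}
    {z w : ∀ k, Z (baseOrbit v m k)} (hz : IsOrbit R m z) (hw : IsOrbit R m w)
    (h : px m (z 0) = px m (w 0)) {b : ℕ → ℝ} (hb : ∀ k, dist (py _ (z k)) (py _ (w k)) ≤ b k)
    (hlim : Tendsto (fun k => cocycle v (fun m => (lu m : ℝ)) m k * b k) atTop (𝓝 0)) :
    z 0 = w 0 := by
  refine D.ext (m := m) h (dist_le_zero.1 (ge_of_tendsto' hlim fun k => ?_))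
  refine (D.orbit_condA hz hw (by rw [h, dist_self]; positivity) k).2.trans ?_
  exact mul_le_mul_of_nonneg_left (hb k) (cocycle_nonneg (fun _ => NNReal.coe_nonneg _) _ _)

/-- Invariance in the other time direction. The graph point over the same `px` also steps to the
graph. The two ends lie in the cone of (A) and on a Lipschitz graph, so `α β < 1` makes them equal,
and (A) carries this back. -/
theorem mem_graph_of_step (D : Dichotomy v R px py α lu β ls) {f : LipFam X Y β}
    (hf : MapsGraph R px py f.1 f.1) {m : M} {z : Z m} {z' : Z (v m)} (h : R m z z')
    (hz' : py _ z' = f.1 (v m) (px _ z')) : py m z = f.1 m (px m z) := by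
  obtain ⟨w, hx, hy⟩ := D.exists_mk m (px m z) (f.1 m (px m z))
  obtain ⟨w', hw, hw'⟩ := hf m w (by rw [hy, hx])
  obtain ⟨a1, a2⟩ := D.condA_of_eq h hw hx.symm
  obtain ⟨θ, h0, h1, -, hang⟩ := D.angle_step
  have e1 := (f.2 (v m)).dist_le_mul (px _ z') (px _ w')
  rw [← hz', ← hw'] at e1
  have e2 : dist (py (v m) z') (py (v m) w') ≤ 0 := by
    have t1 : (β (v m) : ℝ) * dist (px _ z') (px _ w') ≤
      β (v m) * (α m * dist (py (v m) z') (py (v m) w')) := by gcongr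
    have t2 : (α m : ℝ) * β (v m) * dist (py (v m) z') (py (v m) w') ≤
      θ * dist (py (v m) z') (py (v m) w') := by gcongr; exact hang m
    nlinarith [dist_nonneg (x := py (v m) z') (y := py (v m) w')]
  have e3 : dist (py m z) (py m w) ≤ 0 :=
    a2.trans (mul_nonpos_of_nonneg_of_nonpos (NNReal.coe_nonneg _) e2)
  rw [dist_le_zero.1 e3, hy]

theorem graph_step_unique (D : Dichotomy v R px py α lu β ls) (f : LipFam X Y β) {m : M}
    {z : Z m} {z' z'' : Z (v m)} (h : R m z z') (k : R m z z'')
    (hz' : py _ z' = f.1 (v m) (px _ z')) (hz'' : py _ z'' = f.1 (v m) (px _ z'')) : z' = z'' := by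
  have h1 := (D.condB_of_graph h k (f.2 _) hz' hz'').2
  rw [dist_self, mul_zero] at h1
  have h2 := dist_le_zero.1 h1
  exact D.ext h2 (by rw [hz', hz'', h2])

/-- An orbit at bounded distance from an invariant graph lies on it. -/
theorem mem_graph_of_bounded (D : Dichotomy v R px py α lu β ls) {f : LipFam X Y β}
    (hf : MapsGraph R px py f.1 f.1) {m : M}
    (hlu : Tendsto (cocycle v (fun m => (lu m : ℝ)) m) atTop (𝓝 0))
    {z : ∀ k, Z (baseOrbit v m k)} (hz : IsOrbit R m z) {B : ℝ}
    (hB : ∀ k, dist (py _ (z k)) (f.1 _ (px _ (z k))) ≤ B) :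
    py m (z 0) = f.1 m (px m (z 0)) := by
  obtain ⟨w₀, hx, hy⟩ := D.exists_mk m (px m (z 0)) (f.1 m (px m (z 0)))
  obtain ⟨w, hw, hw0, hwf⟩ := exists_graph_orbit hf (z₀ := w₀) (by rw [hy, hx])
  obtain ⟨θ, h0, h1, hang, -⟩ := D.angle_step
  have hx' : px m (z 0) = px m (w 0) := by rw [hw0]; exact hx.symm
  have h1' : 0 < 1 - θ := by linarith
  -- If `d` is the `py`-distance to the orbit inside the graph, then `d ≤ B + α β d`, hence the
  -- bound `B / (1 - θ)`.
  have key := D.orbit_zero_eq hz hw hx' (b := fun _ => B / (1 - θ)) (fun k => ?_) (by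
    simpa using hlu.mul_const (B / (1 - θ)))
  · rw [key]
    exact hwf 0
  · have a := (D.orbit_condA hz hw (by rw [hx', dist_self]; positivity) k).1
    set d := dist (py _ (z k)) (py _ (w k)) with hd
    have hd0 : 0 ≤ d := dist_nonneg
    have t := dist_triangle (py _ (z k)) (f.1 _ (px _ (z k))) (py _ (w k))
    have t1 := (f.2 _).dist_le_mul (px _ (z k)) (px _ (w k))
    rw [← hwf k] at t1
    have t2 : (β (baseOrbit v m k) : ℝ) * dist (px _ (z k)) (px _ (w k)) ≤
      β (baseOrbit v m k) * (α (baseOrbit v m k) * d) := by gcongr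
    have t3 : (α (baseOrbit v m k) : ℝ) * β (baseOrbit v m k) * d ≤ θ * d := by
      gcongr; exact hang _
    rw [le_div_iff₀ h1']
    nlinarith [hB k]

/-- The invariant graph near a pseudo-invariant section consists of the initial points of the
orbits with growth rate `e`. -/
theorem mem_graph_iff_dominated (D : Dichotomy v R px py α lu β ls) {f : LipFam X Y β}
    (hf : MapsGraph R px py f.1 f.1) {i : ∀ m, Z m} {η : M → ℝ≥0} (hη : ∀ m, η (v m) = η m)
    {E : ℝ} (hE : 0 ≤ E) (hnear : ∀ m, dist (f.1 m (px m (i m))) (py m (i m)) ≤ E * η m)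
    (hgrow : ∀ m z z', R m z z' → py _ z' = f.1 (v m) (px _ z') →
        dist (px _ z') (px _ (i (v m))) ≤ ls m * dist (px m z) (px m (i m)) + E * η m)
    {e : M → ℝ} (he : IsRate v ls lu e) (he' : AbsorbsErrors v ls e) (h1 : ∀ m, 1 ≤ e m)
    (m : M) (z₀ : Z m) :
    py m z₀ = f.1 m (px m z₀) ↔ ∃ z, IsOrbit R m z ∧ z 0 = z₀ ∧
      Dominated (fun k => dist (z k) (i (baseOrbit v m k))) (cocycle v e m) := by
  have hpos := cocycle_pos (v := v) he.pos m
  obtain ⟨K, hK, hb⟩ := D.bdd_pos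
  have hηk : ∀ k, η (baseOrbit v m k) = η m := by
    intro k
    induction k with
    | zero => rfl
    | succ k ih => exact (hη _).trans ih
  have hη0 : (0 : ℝ) ≤ η m := NNReal.coe_nonneg _
  have hE1 : ∀ k, 1 ≤ cocycle v e m k := fun k => by
    have : (∏ _j ∈ Finset.range k, (1 : ℝ)) ≤ cocycle v e m k :=
      Finset.prod_le_prod (fun _ _ => zero_le_one) fun _ _ => h1 _
    simpa using this
  have hdom : ∀ z, IsOrbit R m z → (∀ k, py _ (z k) = f.1 _ (px _ (z k))) →
      ∃ C, ∀ k, dist (z k) (i (baseOrbit v m k)) ≤ C * cocycle v e m k := by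
    intro z hz hzf
    obtain ⟨C, hC⟩ := he' m (fun k => dist (px _ (z k)) (px _ (i (baseOrbit v m k)))) (E * η m)
      (fun k => dist_nonneg) (by positivity) (fun k => by
        have := hgrow _ _ _ (hz k) (hzf (k + 1))
        rwa [hηk] at this)
    refine ⟨C + K * C + E * η m, fun k => ?_⟩
    have hCk := hC k
    have hC0 : 0 ≤ C * cocycle v e m k := dist_nonneg.trans hCk
    have hy : dist (py _ (z k)) (py _ (i (baseOrbit v m k))) ≤
        K * (C * cocycle v e m k) + E * η m := by
      have t := dist_triangle (py _ (z k)) (f.1 _ (px _ (i (baseOrbit v m k))))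
        (py _ (i (baseOrbit v m k)))
      have t1 := (f.2 _).dist_le_mul (px _ (z k)) (px _ (i (baseOrbit v m k)))
      rw [← hzf k] at t1
      have t2 := hnear (baseOrbit v m k)
      rw [hηk] at t2
      have t3 : (β (baseOrbit v m k) : ℝ) * dist (px _ (z k)) (px _ (i (baseOrbit v m k))) ≤
          K * (C * cocycle v e m k) :=
        mul_le_mul (hb _).2.2.1 hCk dist_nonneg hK.le
      linarith
    have h4 : E * η m ≤ E * η m * cocycle v e m k := le_mul_of_one_le_right (by positivity) (hE1 k)
    have h5 : 0 ≤ K * (C * cocycle v e m k) := by positivity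
    have h6 : 0 ≤ E * η m := by positivity
    rw [D.dist_eq, max_le_iff]
    constructor <;> linarith
  constructor
  · intro h
    obtain ⟨z, hz, hz0, hzf⟩ := exists_graph_orbit hf h
    exact ⟨z, hz, hz0, (dominated_iff hpos).2 (hdom z hz hzf)⟩
  · rintro ⟨z, hz, rfl, hzd⟩
    obtain ⟨C, hC⟩ := (dominated_iff hpos).1 hzd
    obtain ⟨w₀, hx, hy⟩ := D.exists_mk m (px m (z 0)) (f.1 m (px m (z 0)))
    obtain ⟨w, hw, hw0, hwf⟩ := exists_graph_orbit hf (z₀ := w₀) (by rw [hy, hx])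
    obtain ⟨C', hC'⟩ := hdom w hw hwf
    have hx' : px m (z 0) = px m (w 0) := by rw [hw0]; exact hx.symm
    -- Both orbits stay within a multiple of the cocycle of `e` from the section, and that cocycle
    -- times the one of `lu` tends to `0`.
    have key := D.orbit_zero_eq hz hw hx' (b := fun k => (C + C') * cocycle v e m k) (fun k => ?_) (by
      have := (he.tendsto m).const_mul (C + C')
      rw [mul_zero] at this
      exact this.congr fun k => by ring)
    · rw [key]
      exact hwf 0
    · refine (D.dist_py_le _ _).trans ((dist_triangle_right _ _ (i (baseOrbit v m k))).trans ?_)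
      rw [add_mul]
      exact add_le_add (hC k) (hC' k)

/-- Every orbit has a stable leaf: a graph that consists of initial points of orbits asymptotic
to it. -/
theorem exists_leaf [∀ m, CompleteSpace (Y m)] (D : Dichotomy v R px py α lu β ls) {m : M}
    {z : ∀ k, Z (baseOrbit v m k)} (hz : IsOrbit R m z) :
    ∃ g : X m → Y m, LipschitzWith (β m) g ∧ g (px m (z 0)) = py m (z 0) ∧
      ∀ w₀, py m w₀ = g (px m w₀) → ∃ w, IsOrbit R m w ∧ w 0 = w₀ ∧
        ∃ C, ∀ k, dist (w k) (z k) ≤ C * cocycle v (fun m => (ls m : ℝ)) m k := by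
  let b := baseOrbit v m
  obtain ⟨K, hK, hb⟩ := D.bdd_pos
  -- The dichotomy is pulled back along the base orbit to `ℕ`, where `z` itself becomes a section
  -- even if the base orbit is periodic.
  have Dℕ : Dichotomy (Z := fun k => Z (b k)) (X := fun k => X (b k)) (Y := fun k => Y (b k))
      Nat.succ (fun k => R (b k)) (fun k => px (b k)) (fun k => py (b k)) (fun k => α (b k))
      (fun k => lu (b k)) (fun k => β (b k)) (fun k => ls (b k)) :=
    { dist_eq := fun k => D.dist_eq (b k)
      exists_mk := fun k => D.exists_mk (b k)
      gen := fun k => D.gen (b k)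
      condA := fun k => D.condA (b k)
      condB := fun k => D.condB (b k)
      mono := fun k => D.mono (b k)
      anti := fun k => D.anti (b k)
      angle := D.angle.imp fun θ h => ⟨h.1, fun k => h.2 _⟩
      spec := D.spec.imp fun θ h => ⟨h.1, fun k => h.2 _⟩
      bdd := ⟨K, fun k => hb _⟩ }
  have hi : NearInvariant (Z := fun k => Z (b k)) (v := Nat.succ) (fun k => R (b k)) z 0 :=
    ⟨fun _ => rfl, fun k => ⟨z k, z (k + 1), hz k, by simp, by simp⟩⟩
  -- The section is exactly invariant, so `η = 0`. Hence `1 / 2` is an arbitrary choice, and no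
  -- bound `lu < 1` is required.
  obtain ⟨g, hg, E, hE, hnear, hgrow⟩ := Dℕ.exists_graph hi (θ := 1 / 2) (by norm_num) (by simp)
  refine ⟨g.1 0, g.2 0, ?_, fun w₀ hw₀ => ?_⟩
  · have := hnear 0
    simp only [Pi.zero_apply, NNReal.coe_zero, mul_zero] at this
    exact dist_le_zero.1 this
  · obtain ⟨w, hw, hw0, hwg⟩ := exists_orbit_of_invariant (R := R) (m := m)
      (fun k z => py _ z = g.1 k (px _ z)) (fun k z hz => hg k z hz) w₀ hw₀
    refine ⟨w, hw, hw0, (1 + K) * dist (px m (w 0)) (px m (z 0)), fun k => ?_⟩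
    have hx : dist (px _ (w k)) (px _ (z k)) ≤
        cocycle v (fun m => (ls m : ℝ)) m k * dist (px m (w 0)) (px m (z 0)) := by
      induction k with
      | zero => simp only [cocycle, Finset.range_zero, Finset.prod_empty, one_mul]; rfl
      | succ k ih =>
        have h1 := hgrow k _ _ (hw k) (hwg (k + 1))
        simp only [Pi.zero_apply, NNReal.coe_zero, mul_zero, add_zero] at h1
        rw [cocycle_succ, mul_comm (cocycle _ _ _ _), mul_assoc]
        exact h1.trans (mul_le_mul_of_nonneg_left ih (NNReal.coe_nonneg _))
    have hy : dist (py _ (w k)) (py _ (z k)) ≤ K * dist (px _ (w k)) (px _ (z k)) := by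
      have h1 := hnear k
      simp only [Pi.zero_apply, NNReal.coe_zero, mul_zero] at h1
      have h2 := (g.2 k).dist_le_mul (px _ (w k)) (px _ (z k))
      rw [← hwg k, dist_le_zero.1 h1] at h2
      exact h2.trans (mul_le_mul_of_nonneg_right (hb _).2.2.1 dist_nonneg)
    have h3 : dist (w k) (z k) ≤ (1 + K) * dist (px _ (w k)) (px _ (z k)) := by
      rw [D.dist_eq, max_le_iff]
      have := dist_nonneg (x := px _ (w k)) (y := px _ (z k))
      constructor
      · nlinarith
      · linarith
    calc _ ≤ _ := h3
      _ ≤ (1 + K) * (cocycle v (fun m => (ls m : ℝ)) m k * dist (px m (w 0)) (px m (z 0))) := by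
          gcongr
      _ = _ := by ring

end Dichotomy
-- Shifted orbits, leaves inside an invariant graph, and tracking.
theorem exists_orbit_shift {M : Type*} {Z : M → Type*} {v : M → M}
    {R : ∀ m, Z m → Z (v m) → Prop} {m : M} {z : ∀ k, Z (baseOrbit v m k)} (hz : IsOrbit R m z) :
    ∃ z' : ∀ k, Z (baseOrbit v (v m) k), IsOrbit R (v m) z' ∧
      ∀ k (P : ∀ m, Z m → Prop), P _ (z' k) ↔ P _ (z (k + 1)) := by
  have aux : ∀ {a a' : M} (h : a = a') (h' : v a = v a') (x : Z a) (y : Z (v a)),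
      R a x y → R a' (h ▸ x) (h' ▸ y) := by
    rintro a _ rfl _ x y h
    exact h
  have aux' : ∀ {a a' : M} (h : a = a') (x : Z a) (P : ∀ m, Z m → Prop),
      P _ (h ▸ x : Z a') ↔ P _ x := by
    rintro a _ rfl x P
    rfl
  exact ⟨fun k => (baseOrbit_succ' v m k).symm ▸ z (k + 1),
    fun k => aux (baseOrbit_succ' v m k).symm (baseOrbit_succ' v m (k + 1)).symm _ _ (hz (k + 1)),
    fun k P => aux' _ _ _⟩

/-- The two sides live over propositionally equal base points; quantifying over predicates avoids
writing the transport. -/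
theorem iterateMap_succ' {M : Type*} {W : M → Type*} {v : M → M} (h : ∀ m, W m → W (v m))
    {m : M} (k : ℕ) (z z' : W m) (P : ∀ m, W m → W m → Prop) :
    P _ (iterateMap h (v m) k (h m z)) (iterateMap h (v m) k (h m z')) ↔
      P _ (iterateMap h m (k + 1) z) (iterateMap h m (k + 1) z') := by
  induction k generalizing P with
  | zero => rfl
  | succ k ih => exact ih (fun a x y => P (v a) (h a x) (h a y))

theorem cocycle_le_one {M : Type*} {v : M → M} {l : M → ℝ≥0} (h : SupLTOne fun m => (l m : ℝ))
    (m : M) (k : ℕ) : cocycle v (fun m => (l m : ℝ)) m k ≤ 1 := by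
  obtain ⟨θ, h1, h⟩ := h
  exact Finset.prod_le_one (fun _ _ => NNReal.coe_nonneg _) fun _ _ => (h _).trans h1.le

theorem cocycle_tendsto_zero {M : Type*} {v : M → M} {l : M → ℝ≥0}
    (h : SupLTOne fun m => (l m : ℝ)) (m : M) :
    Tendsto (cocycle v (fun m => (l m : ℝ)) m) atTop (𝓝 0) := by
  obtain ⟨θ, h0, h1, h⟩ := h.exists_pos
  refine squeeze_zero (fun k => cocycle_nonneg (fun _ => NNReal.coe_nonneg _) _ _) (fun k => ?_)
    (tendsto_pow_atTop_nhds_zero_of_lt_one h0.le h1)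
  calc _ ≤ ∏ _j ∈ Finset.range k, θ :=
        Finset.prod_le_prod (fun _ _ => NNReal.coe_nonneg _) fun _ _ => h _
    _ = θ ^ k := by simp

/-- The graphs of a family of maps between the factors. -/
def graphSet {M : Type*} {Z X Y : M → Type*} (px : ∀ m, Z m → X m) (py : ∀ m, Z m → Y m)
    (f : ∀ m, X m → Y m) (m : M) : Set (Z m) :=
  {z | py m z = f m (px m z)}

/-- Two Lipschitz maps in opposite directions with contracting composition have graphs that
meet in exactly one point. -/
theorem existsUnique_graph_inter {A B : Type*} [MetricSpace A] [CompleteSpace A] [MetricSpace B]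
    (a₀ : A) {g : A → B} {k : B → A} {K L : ℝ≥0} (hg : LipschitzWith K g)
    (hk : LipschitzWith L k) (h : (L : ℝ) * K < 1) : ∃! a, a = k (g a) := by
  have hd : ∀ a a', dist (k (g a)) (k (g a')) ≤ (L * K : ℝ) * dist a a' := fun a a' =>
    (hk.comp hg).dist_le_mul a a'
  obtain ⟨a, ha⟩ := exists_fixedPoint_of_dist_le a₀ (fun a => k (g a)) h hd
  refine ⟨a, ha.symm, fun a' (ha' : a' = k (g a')) => ?_⟩
  have := hd a' a
  rw [← ha', ha] at this
  exact dist_le_zero.1 (by nlinarith [dist_nonneg (x := a') (y := a)])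

section Side

variable {M : Type*} {Z X Y : M → Type*} [∀ m, MetricSpace (Z m)]
  [∀ m, MetricSpace (X m)] [∀ m, MetricSpace (Y m)] {v : M → M}
  {R : ∀ m, Z m → Z (v m) → Prop} {px : ∀ m, Z m → X m} {py : ∀ m, Z m → Y m}
  {α lu β ls : M → ℝ≥0}

theorem Dichotomy.forall_mem_graph_of_bounded (D : Dichotomy v R px py α lu β ls)
    {f : LipFam X Y β} (hf : MapsGraph R px py f.1 f.1) (hlu : SupLTOne fun m => (lu m : ℝ))
    {B : ℝ} (k : ℕ) :
    ∀ {m : M} {z : ∀ k, Z (baseOrbit v m k)}, IsOrbit R m z →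
      (∀ k, dist (py _ (z k)) (f.1 _ (px _ (z k))) ≤ B) → z k ∈ graphSet px py f.1 _ := by
  induction k with
  | zero => exact fun hz hB => D.mem_graph_of_bounded hf (cocycle_tendsto_zero hlu _) hz hB
  | succ k ih =>
    intro m z hz hB
    obtain ⟨z', hz', hP⟩ := exists_orbit_shift hz
    refine (hP k (fun m z => z ∈ graphSet px py f.1 m)).1 (ih hz' fun j => ?_)
    exact (hP j (fun m z => dist (py m z) (f.1 m (px m z)) ≤ B)).2 (hB (j + 1))

/-- Points near a graph. -/
theorem Dichotomy.dist_graph_le (D : Dichotomy v R px py α lu β ls) :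
    ∃ K : ℝ, 0 < K ∧ ∀ (f : LipFam X Y β) m z w, w ∈ graphSet px py f.1 m →
      dist (py m z) (f.1 m (px m z)) ≤ K * dist z w := by
  obtain ⟨K, hK, hb⟩ := D.bdd_pos
  refine ⟨1 + K, by positivity, fun f m z w hw => ?_⟩
  have t := dist_triangle (py m z) (py m w) (f.1 m (px m z))
  have t1 := (f.2 m).dist_le_mul (px m w) (px m z)
  rw [← show py m w = f.1 m (px m w) from hw] at t1
  have t2 : (β m : ℝ) * dist (px m w) (px m z) ≤ K * dist z w := by
    rw [dist_comm z w]
    exact mul_le_mul (hb m).2.2.1 (D.dist_px_le _ _) dist_nonneg hK.le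
  linarith [D.dist_py_le z w]

/-- The bundle map induced on an invariant graph. -/
theorem Dichotomy.exists_graphMap (D : Dichotomy v R px py α lu β ls)
    {f : LipFam X Y β} (hf : MapsGraph R px py f.1 f.1) :
    ∃ h : ∀ m, graphSet px py f.1 m → graphSet px py f.1 (v m),
      (∀ m z z', R m z.1 z'.1 ↔ z' = h m z) ∧
      ∃ hx : ∀ m, X m → X (v m), (∀ m, LipschitzWith (ls m) (hx m)) ∧
        ∀ m z, px _ (h m z).1 = hx m (px _ z.1) := by
  choose h hR hh using hf
  let h' : ∀ m, graphSet px py f.1 m → graphSet px py f.1 (v m) :=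
    fun m z => ⟨h m z.1 z.2, hh m z.1 z.2⟩
  choose s hsx hsy using fun m x => D.exists_mk m x (f.1 m x)
  have hs : ∀ m x, s m x ∈ graphSet px py f.1 m := fun m x => by
    change py m (s m x) = f.1 m (px m (s m x))
    rw [hsy, hsx]
  refine ⟨h', fun m z z' => ⟨fun hz => ?_, ?_⟩, fun m x => px _ (h' m ⟨s m x, hs m x⟩).1,
    fun m => LipschitzWith.of_dist_le_mul fun x x' => ?_, fun m z => ?_⟩
  · exact Subtype.ext (D.graph_step_unique f hz (hR m z.1 z.2) z'.2 (hh m z.1 z.2))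
  · rintro rfl
    exact hR m z.1 z.2
  · have := (D.condB_of_graph (hR m _ (hs m x)) (hR m _ (hs m x')) (f.2 _) (hh m _ (hs m x))
      (hh m _ (hs m x'))).2
    rwa [hsx, hsx] at this
  · have : (⟨s m (px m z.1), hs m _⟩ : graphSet px py f.1 m) = z :=
      Subtype.ext (D.ext (hsx m _) ((hsy m _).trans z.2.symm))
    simp only [this]

variable {X₂ Y₂ : M → Type*} [∀ m, MetricSpace (X₂ m)] [∀ m, MetricSpace (Y₂ m)]
  [∀ m, CompleteSpace (Y₂ m)] {qx : ∀ m, Z m → X₂ m}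
  {qy : ∀ m, Z m → Y₂ m} {α₂ lu₂ β₂ ls₂ : M → ℝ≥0} {t : M → ℝ}

/-- Every orbit is shadowed by an orbit inside a forward invariant graph transverse to the
stable leaves. -/
theorem Dichotomy.exists_tracking [∀ m, CompleteSpace (X₂ m)]
    (D₂ : Dichotomy v R qx qy α₂ lu₂ β₂ ls₂)
    (ht : IsRate v ls₂ lu₂ t) {V : ∀ m, Set (Z m)}
    (hV : ∀ m z z', R m z z' → z ∈ V m → z' ∈ V (v m)) {γ : M → ℝ≥0}
    {k : ∀ m, Y₂ m → X₂ m} (hk : ∀ m, LipschitzWith (γ m) (k m))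
    (hVk : ∀ m z, z ∈ V m ↔ qx m z = k m (qy m z)) (hγ : ∀ m, (γ m : ℝ) * β₂ m < 1)
    {m : M} {z : ∀ k, Z (baseOrbit v m k)} (hz : IsOrbit R m z) :
    ∃ w, IsOrbit R m w ∧ (∀ k, w k ∈ V _) ∧
      Dominated (fun k => dist (z k) (w k)) (cocycle v t m) := by
  obtain ⟨g, hg, -, hgo⟩ := D₂.exists_leaf hz
  -- The tracking orbit starts where the leaf of `z` meets `V`. It is asymptotic to `z` as an orbit
  -- from the leaf, and it stays in `V` by forward invariance.
  obtain ⟨x, hx, -⟩ := existsUnique_graph_inter (qx m (z 0)) hg (hk m) (hγ m)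
  obtain ⟨w₀, hwx, hwy⟩ := D₂.exists_mk m x (g x)
  obtain ⟨w, hw, hw0, C, hC⟩ := hgo w₀ (by rw [hwy, hwx])
  obtain ⟨C', hC'⟩ := ht.exists_le m
  refine ⟨w, hw, fun k => ?_, (dominated_iff (cocycle_pos ht.pos m)).2 ⟨C * C', fun k => ?_⟩⟩
  · induction k with
    | zero =>
      rw [hw0]
      exact (hVk m w₀).2 (by rw [hwx, hwy]; exact hx)
    | succ k ih => exact hV _ _ _ (hw k) ih
  · have hC0 : 0 ≤ C := by
      have := dist_nonneg.trans (hC 0)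
      simpa [cocycle] using this
    rw [dist_comm, mul_assoc]
    exact (hC k).trans (mul_le_mul_of_nonneg_left (hC' k) hC0)

/-- The strong stable leaf of `z` inside a family of sets with a bundle map `h`: the points whose
orbits approach the one of `z` at rate `t`. -/
def strongLeaf {v : M → M} {W : ∀ m, Set (Z m)} (h : ∀ m, W m → W (v m)) (t : M → ℝ) (m : M)
    (z : Z m) : Set (Z m) :=
  {z' | ∃ (hz : z ∈ W m) (hz' : z' ∈ W m),
    Dominated (fun k => dist (iterateMap (Z := fun m => W m) h m k ⟨z', hz'⟩).1
      (iterateMap (Z := fun m => W m) h m k ⟨z, hz⟩).1) (cocycle v t m)}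

theorem mem_strongLeaf_iff {W : ∀ m, Set (Z m)} {h : ∀ m, W m → W (v m)} {m : M}
    (z z' : W m) : z'.1 ∈ strongLeaf h t m z.1 ↔
      Dominated (fun k => dist (iterateMap (Z := fun m => W m) h m k z').1
        (iterateMap (Z := fun m => W m) h m k z).1) (cocycle v t m) :=
  ⟨fun ⟨_, _, H⟩ => H, fun H => ⟨z.2, z'.2, H⟩⟩

theorem mem_strongLeaf_self {W : ∀ m, Set (Z m)} {h : ∀ m, W m → W (v m)} {m : M} {z : Z m}
    (hz : z ∈ W m) : z ∈ strongLeaf h t m z :=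
  ⟨hz, hz, 0, by rintro _ ⟨k, rfl⟩; simp⟩

theorem strongLeaf_subset {W : ∀ m, Set (Z m)} {h : ∀ m, W m → W (v m)} {m : M} {z : Z m} :
    strongLeaf h t m z ⊆ W m :=
  fun _ ⟨_, hz', _⟩ => hz'

theorem mem_strongLeaf_comm {W : ∀ m, Set (Z m)} {h : ∀ m, W m → W (v m)} {m : M} {z z' : Z m} :
    z' ∈ strongLeaf h t m z ↔ z ∈ strongLeaf h t m z' := by
  constructor <;>
  · rintro ⟨h1, h2, H⟩
    refine ⟨h2, h1, ?_⟩
    simpa only [dist_comm] using H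

theorem strongLeaf_invariant (ht : ∀ m, 0 < t m) {W : ∀ m, Set (Z m)} {h : ∀ m, W m → W (v m)}
    {m : M} {z z' : W m} (hz : z'.1 ∈ strongLeaf h t m z.1) :
    (h m z').1 ∈ strongLeaf h t (v m) (h m z).1 := by
  rw [mem_strongLeaf_iff, dominated_iff (cocycle_pos ht _)] at hz ⊢
  obtain ⟨C, hC⟩ := hz
  refine ⟨C * t m, fun k => ?_⟩
  refine (iterateMap_succ' (W := fun m => W m) h k z' z
    (fun a x y => dist x.1 y.1 ≤ C * t m * cocycle v t (v m) k)).2 ?_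
  have := hC (k + 1)
  rw [cocycle_succ'] at this
  exact this.trans (by rw [mul_assoc, mul_comm (t m)])

/-- The strong stable leaves in an invariant graph are Lipschitz graphs, and orbits in them
approach each other at rate `ls₂`. -/
theorem Dichotomy.strongLeaf_eq_graph (D : Dichotomy v R px py α lu β ls)
    (D₂ : Dichotomy v R qx qy α₂ lu₂ β₂ ls₂) {f : LipFam X Y β}
    (hf : MapsGraph R px py f.1 f.1) (hlu : SupLTOne fun m => (lu m : ℝ))
    (hls : SupLTOne fun m => (ls₂ m : ℝ)) (ht : IsRate v ls₂ lu₂ t)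
    {h : ∀ m, graphSet px py f.1 m → graphSet px py f.1 (v m)}
    (hh : ∀ m z z', R m z.1 z'.1 ↔ z' = h m z) (m : M) (z : graphSet px py f.1 m) :
    (∃ g : X₂ m → Y₂ m, LipschitzWith (β₂ m) g ∧
      strongLeaf h t m z.1 = {z' | qy m z' = g (qx m z')}) ∧
    ∀ z' : graphSet px py f.1 m, z'.1 ∈ strongLeaf h t m z.1 →
      ∃ C, ∀ k, dist (iterateMap (Z := fun m => graphSet px py f.1 m) h m k z').1
        (iterateMap (Z := fun m => graphSet px py f.1 m) h m k z).1 ≤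
          C * cocycle v (fun m => (ls₂ m : ℝ)) m k := by
  set I := iterateMap (Z := fun m => graphSet px py f.1 m) h m with hI
  have horb : ∀ z, IsOrbit R m (fun k => (I k z).1) := fun z k => (hh _ (I k z) (I (k + 1) z)).2 rfl
  -- The leaf is that of the finer dichotomy `D₂`, built in the full space. That it lies inside the
  -- graph of `f` is the content of `hgood`.
  obtain ⟨g, hg, hgz, hgo⟩ := D₂.exists_leaf (horb z)
  obtain ⟨K, hK, hd⟩ := D.dist_graph_le
  obtain ⟨C', hC'⟩ := ht.exists_le m
  have hpos := cocycle_pos (v := v) ht.pos m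
  have hgood : ∀ w₀, qy m w₀ = g (qx m w₀) → ∃ hw : w₀ ∈ graphSet px py f.1 m, ∃ C, 0 ≤ C ∧ ∀ k,
      dist (I k ⟨w₀, hw⟩).1 (I k z).1 ≤ C * cocycle v (fun m => (ls₂ m : ℝ)) m k := by
    intro w₀ hw₀
    obtain ⟨w, hw, hw0, C, hC⟩ := hgo w₀ hw₀
    have hC0 : 0 ≤ C := by
      have := dist_nonneg.trans (hC 0)
      simpa [cocycle] using this
    -- As `ls₂` contracts, the leaf orbit stays at bounded distance from an orbit in the graph of
    -- `f`, so all of it lies in that graph.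
    have hmem : ∀ k, w k ∈ graphSet px py f.1 _ := fun k =>
      D.forall_mem_graph_of_bounded hf hlu (B := K * C) k hw fun j => by
        refine (hd f _ (w j) _ (I j z).2).trans ?_
        gcongr
        exact (hC j).trans (mul_le_of_le_one_right hC0 (cocycle_le_one hls m j))
    have hw0' : w₀ ∈ graphSet px py f.1 m := hw0 ▸ hmem 0
    refine ⟨hw0', C, hC0, fun k => ?_⟩
    have : ∀ k, I k ⟨w₀, hw0'⟩ = ⟨w k, hmem k⟩ := by
      intro k
      induction k with
      | zero => exact Subtype.ext hw0.symm
      | succ k ih =>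
        have h1 := (hh _ ⟨w k, hmem k⟩ ⟨w (k + 1), hmem (k + 1)⟩).1 (hw k)
        refine Eq.trans ?_ h1.symm
        rw [← ih]
        rfl
    rw [this]
    exact hC k
  have huniq : ∀ z' : graphSet px py f.1 m, z'.1 ∈ strongLeaf h t m z.1 →
      qy m z'.1 = g (qx m z'.1) := by
    intro z' hz'
    rw [mem_strongLeaf_iff, dominated_iff hpos] at hz'
    obtain ⟨C₁, hC₁⟩ := hz'
    obtain ⟨w₀, hwx, hwy⟩ := D₂.exists_mk m (qx m z'.1) (g (qx m z'.1))
    obtain ⟨hw, C, hC0, hC⟩ := hgood w₀ (by rw [hwy, hwx])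
    -- Conversely, a point asymptotic at rate `t` is compared with the leaf point over the same
    -- `qx`; both orbits remain within rate `t` of each other and `lu₂ * t` contracts.
    have key := D₂.orbit_zero_eq (horb z') (horb ⟨w₀, hw⟩) hwx.symm
      (b := fun k => (C₁ + C * C') * cocycle v t m k) (fun k => ?_) (by
        have := (ht.tendsto m).const_mul (C₁ + C * C')
        rw [mul_zero] at this
        exact this.congr fun k => by ring)
    · have key' : z'.1 = w₀ := key
      rw [key', hwy, hwx, key']
    · refine (D₂.dist_py_le _ _).trans ((dist_triangle_right _ _ (I k z).1).trans ?_)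
      rw [add_mul]
      refine add_le_add (hC₁ k) ((hC k).trans ?_)
      rw [mul_assoc]
      exact mul_le_mul_of_nonneg_left (hC' k) hC0
  refine ⟨⟨g, hg, Set.ext fun z' => ⟨fun hz' => huniq ⟨z', strongLeaf_subset hz'⟩ hz', fun hz' => ?_⟩⟩,
    fun z' hz' => ?_⟩
  · obtain ⟨hw, C, hC0, hC⟩ := hgood z' hz'
    refine (mem_strongLeaf_iff z ⟨z', hw⟩).2 ((dominated_iff hpos).2 ⟨C * C', fun k => ?_⟩)
    refine (hC k).trans ?_
    rw [mul_assoc]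
    exact mul_le_mul_of_nonneg_left (hC' k) hC0
  · obtain ⟨_, C, _, hC⟩ := hgood z'.1 (huniq z' hz')
    exact ⟨C, hC⟩

/-- The projection of an invariant graph along its strong stable leaves. -/
theorem Dichotomy.exists_leafProjection [∀ m, CompleteSpace (X₂ m)]
    (D : Dichotomy v R px py α lu β ls)
    (D₂ : Dichotomy v R qx qy α₂ lu₂ β₂ ls₂) {f : LipFam X Y β}
    (hf : MapsGraph R px py f.1 f.1) (hlu : SupLTOne fun m => (lu m : ℝ))
    (hls : SupLTOne fun m => (ls₂ m : ℝ)) (ht : IsRate v ls₂ lu₂ t)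
    {h : ∀ m, graphSet px py f.1 m → graphSet px py f.1 (v m)}
    (hh : ∀ m z z', R m z.1 z'.1 ↔ z' = h m z) {V C : ∀ m, Set (Z m)} {γ : M → ℝ≥0}
    {k : ∀ m, Y₂ m → X₂ m} (hk : ∀ m, LipschitzWith (γ m) (k m))
    (hVk : ∀ m z, z ∈ V m ↔ qx m z = k m (qy m z)) (hγ : ∀ m, (γ m : ℝ) * β₂ m < 1)
    (hC : ∀ m z, z ∈ C m ↔ z ∈ graphSet px py f.1 m ∧ z ∈ V m) :
    ∃ p : ∀ m, graphSet px py f.1 m → C m, ∀ m, Function.Surjective (p m) ∧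
      ∀ (z : graphSet px py f.1 m) (w : C m), p m z = w ↔ z.1 ∈ strongLeaf h t m w.1 := by
  have key : ∀ m (z : graphSet px py f.1 m), ∃! w : C m, w.1 ∈ strongLeaf h t m z.1 := by
    intro m z
    obtain ⟨⟨g, hg, hgz⟩, -⟩ := D.strongLeaf_eq_graph D₂ hf hlu hls ht hh m z
    -- The projection of `z` is the unique point of its leaf in `V`; symmetry of the leaf relation
    -- then describes the fibers.
    obtain ⟨x, hx, hux⟩ := existsUnique_graph_inter (qx m z.1) hg (hk m) (hγ m)
    obtain ⟨w, hwx, hwy⟩ := D₂.exists_mk m x (g x)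
    have hw : w ∈ strongLeaf h t m z.1 := by
      rw [hgz]; simp only [Set.mem_ofPred_eq]; rw [hwy, hwx]
    refine ⟨⟨w, (hC m w).2 ⟨strongLeaf_subset hw, (hVk m w).2 (by rw [hwx, hwy]; exact hx)⟩⟩,
      hw, fun w' hw' => ?_⟩
    have h1 : qx m w'.1 = k m (qy m w'.1) := (hVk m _).1 ((hC m _).1 w'.2).2
    simp only [hgz, Set.mem_ofPred_eq] at hw'
    have h2 : qx m w'.1 = x := hux _ (by simp only; rw [← hw']; exact h1)
    exact Subtype.ext (D₂.ext (h2.trans hwx.symm) (by rw [hw', hwy, h2]))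
  choose p hp hpu using key
  have hiff : ∀ m (z : graphSet px py f.1 m) (w : C m),
      p m z = w ↔ z.1 ∈ strongLeaf h t m w.1 := fun m z w =>
    ⟨fun e => mem_strongLeaf_comm.1 (e ▸ hp m z),
      fun e => (hpu m z w (mem_strongLeaf_comm.1 e)).symm⟩
  refine ⟨p, fun m => ⟨fun w => ?_, hiff m⟩⟩
  have hw := ((hC m _).1 w.2).1
  exact ⟨⟨w.1, hw⟩, (hiff m _ _).2 (mem_strongLeaf_self hw)⟩

/-- The invariant graph consists of the initial points of the orbits that approach, or stay near,
its intersection with a transverse forward invariant graph. -/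
theorem Dichotomy.mem_graph_iff_infDist (D : Dichotomy v R px py α lu β ls)
    (D₂ : Dichotomy v R qx qy α₂ lu₂ β₂ ls₂) {f : LipFam X Y β}
    (hf : MapsGraph R px py f.1 f.1) (hlu : SupLTOne fun m => (lu m : ℝ))
    (hls : SupLTOne fun m => (ls₂ m : ℝ)) (ht : IsRate v ls₂ lu₂ t)
    {h : ∀ m, graphSet px py f.1 m → graphSet px py f.1 (v m)}
    (hh : ∀ m z z', R m z.1 z'.1 ↔ z' = h m z) {V C : ∀ m, Set (Z m)}
    (hV : ∀ m z z', R m z z' → z ∈ V m → z' ∈ V (v m))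
    (hC : ∀ m z, z ∈ C m ↔ z ∈ graphSet px py f.1 m ∧ z ∈ V m) (hne : ∀ m, (C m).Nonempty)
    {p : ∀ m, graphSet px py f.1 m → C m}
    (hp : ∀ m (z : graphSet px py f.1 m) (w : C m), p m z = w ↔ z.1 ∈ strongLeaf h t m w.1)
    (m : M) :
    graphSet px py f.1 m = {z₀ | ∃ z, IsOrbit R m z ∧ z 0 = z₀ ∧
      Tendsto (fun k => Metric.infDist (z k) (C (baseOrbit v m k))) atTop (𝓝 0)} ∧
    graphSet px py f.1 m = {z₀ | ∃ z, IsOrbit R m z ∧ z 0 = z₀ ∧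
      BddAbove (Set.range fun k => Metric.infDist (z k) (C (baseOrbit v m k)))} := by
  have h1 : ∀ z₀ ∈ graphSet px py f.1 m, ∃ z, IsOrbit R m z ∧ z 0 = z₀ ∧
      Tendsto (fun k => Metric.infDist (z k) (C (baseOrbit v m k))) atTop (𝓝 0) := by
    intro z₀ hz₀
    set I := iterateMap (Z := fun m => graphSet px py f.1 m) h m with hI
    have horb : ∀ z, IsOrbit R m (fun k => (I k z).1) :=
      fun z k => (hh _ (I k z) (I (k + 1) z)).2 rfl
    refine ⟨fun k => (I k ⟨z₀, hz₀⟩).1, horb _, rfl, ?_⟩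
    have hw := (hC m _).1 (p m ⟨z₀, hz₀⟩).2
    set w : graphSet px py f.1 m := ⟨(p m ⟨z₀, hz₀⟩).1, hw.1⟩ with hwdef
    obtain ⟨B, hB⟩ := (D.strongLeaf_eq_graph D₂ hf hlu hls ht hh m w).2 ⟨z₀, hz₀⟩
      ((hp m _ _).1 rfl)
    have hIw : ∀ k, (I k w).1 ∈ C _ := by
      intro k
      refine (hC _ _).2 ⟨(I k w).2, ?_⟩
      induction k with
      | zero => exact hw.2
      | succ k ih => exact hV _ _ _ (horb w k) ih
    have hlim := (cocycle_tendsto_zero (v := v) hls m).const_mul B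
    rw [mul_zero] at hlim
    exact squeeze_zero (fun _ => Metric.infDist_nonneg)
      (fun k => (Metric.infDist_le_dist_of_mem (hIw k)).trans (hB k)) hlim
  have h2 : ∀ z₀, (∃ z, IsOrbit R m z ∧ z 0 = z₀ ∧
      BddAbove (Set.range fun k => Metric.infDist (z k) (C (baseOrbit v m k)))) →
      z₀ ∈ graphSet px py f.1 m := by
    rintro z₀ ⟨z, hz, rfl, B, hB⟩
    obtain ⟨K, hK, hd⟩ := D.dist_graph_le
    -- The infimum distance need not be attained, so `B + 1` provides the strict inequality that
    -- yields an actual point of `C`.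
    refine D.mem_graph_of_bounded hf (cocycle_tendsto_zero hlu m) hz (B := K * (B + 1)) fun k => ?_
    have hk : Metric.infDist (z k) (C (baseOrbit v m k)) < B + 1 :=
      (hB ⟨k, rfl⟩).trans_lt (lt_add_one B)
    obtain ⟨w, hw, hdw⟩ := (Metric.infDist_lt_iff (hne _)).1 hk
    exact (hd f _ _ w ((hC _ _).1 hw).1).trans (by gcongr)
  constructor
  · refine Set.ext fun z₀ => ⟨h1 z₀, fun ⟨z, hz, h0, hl⟩ => h2 z₀ ⟨z, hz, h0, hl.bddAbove_range⟩⟩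
  · refine Set.ext fun z₀ => ⟨fun hz₀ => ?_, h2 z₀⟩
    obtain ⟨z, hz, h0, hl⟩ := h1 z₀ hz₀
    exact ⟨z, hz, h0, hl.bddAbove_range⟩

end Side

/-! ### Inversion of the correspondence. -/

/-- The inverse correspondence, over the inverse base map. -/
def inverseStep {M : Type*} {Z : M → Type*} {u : Equiv.Perm M}
    (H : ∀ m, Z m → Z (u m) → Prop) (m : M) (z : Z m) (z' : Z (u.symm m)) : Prop :=
  Step H z' z

theorem step_iff {M : Type*} {Z : M → Type*} {u : Equiv.Perm M} {H : ∀ m, Z m → Z (u m) → Prop}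
    {m : M} {z : Z m} {z' : Z (u m)} : Step H z z' ↔ H m z z' :=
  ⟨fun ⟨_, h⟩ => h, fun h => ⟨rfl, h⟩⟩

section Dual

variable {M : Type*} {Z X Y : M → Type*} [∀ m, MetricSpace (Z m)]
  [∀ m, MetricSpace (X m)] [∀ m, MetricSpace (Y m)] {u : Equiv.Perm M}
  {H : ∀ m, Z m → Z (u m) → Prop} {px : ∀ m, Z m → X m} {py : ∀ m, Z m → Y m}
  {α lu β ls : M → ℝ≥0}

/-- Read backwards, (B) becomes (A) and conversely. The constants of the inverse step from `m` are
those of the forward step from `u.symm m`, whence the compositions. -/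
theorem Dichotomy.dual (D : Dichotomy u H px py α lu β ls) :
    Dichotomy u.symm (inverseStep H) py px (β ∘ u.symm) (ls ∘ u.symm) (α ∘ u.symm)
      (lu ∘ u.symm) where
  dist_eq m z w := by rw [D.dist_eq, max_comm]
  exists_mk m y x := (D.exists_mk m x y).imp fun _ h => h.symm
  gen m y x := by
    -- Replacing `u.symm m` by a free `n` with `m = u n` allows substitution, which removes the
    -- transport hidden in `Step`.
    have aux : ∀ {n m : M} (_ : m = u n) (y : Y m) (x : X n),
        ∃ (z : Z m) (z' : Z n), Step H z' z ∧ py m z = y ∧ px n z' = x := by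
      rintro n _ rfl y x
      obtain ⟨z', z, h, h1, h2⟩ := D.gen n x y
      exact ⟨z, z', step_iff.2 h, h2, h1⟩
    exact aux (u.apply_symm_apply m).symm y x
  condA m z z' w w' hz hw := by
    have aux : ∀ {n m : M} (_ : m = u n) (z w : Z m) (z' w' : Z n), Step H z' z → Step H w' w →
        dist (py m z) (py m w) ≤ β n * dist (px m z) (px m w) →
        dist (py n z') (py n w') ≤ β n * dist (px n z') (px n w') ∧
          dist (px m z) (px m w) ≤ ls n * dist (px n z') (px n w') := by
      rintro n _ rfl z w z' w' hz hw
      exact D.condB n z' z w' w (step_iff.1 hz) (step_iff.1 hw)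
    exact aux (u.apply_symm_apply m).symm z w z' w' hz hw
  condB m z z' w w' hz hw := by
    have aux : ∀ {n m : M} (_ : m = u n) (z w : Z m) (z' w' : Z n), Step H z' z → Step H w' w →
        dist (px n z') (px n w') ≤ α n * dist (py n z') (py n w') →
        dist (px m z) (px m w) ≤ α n * dist (py m z) (py m w) ∧
          dist (py n z') (py n w') ≤ lu n * dist (py m z) (py m w) := by
      rintro n _ rfl z w z' w' hz hw
      exact D.condA n z' z w' w (step_iff.1 hz) (step_iff.1 hw)
    exact aux (u.apply_symm_apply m).symm z w z' w' hz hw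
  mono m := by
    have := D.anti (u.symm (u.symm m))
    rwa [u.apply_symm_apply] at this
  anti m := by
    have := D.mono (u.symm (u.symm m))
    rwa [u.apply_symm_apply] at this
  angle := D.angle.imp fun _ h => ⟨h.1, fun m => (mul_comm _ _).le.trans (h.2 (u.symm m))⟩
  spec := D.spec.imp fun _ h => ⟨h.1, fun m => (mul_comm _ _).le.trans (h.2 (u.symm m))⟩
  bdd := D.bdd.imp fun K h m =>
    ⟨(h (u.symm m)).2.2.1, (h (u.symm m)).2.2.2, (h (u.symm m)).1, (h (u.symm m)).2.1⟩

theorem NearInvariant.dual {i : ∀ m, Z m} {η : M → ℝ≥0} (h : NearInvariant H i η) :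
    NearInvariant (inverseStep H) i η where
  invariant m := by
    have := h.invariant (u.symm m)
    rw [u.apply_symm_apply] at this
    exact this.symm
  exists_near m := by
    have aux : ∀ {n m : M} (_ : m = u n), ∃ (z : Z m) (z' : Z n), Step H z' z ∧
        dist z (i m) ≤ η m ∧ dist z' (i n) ≤ η m := by
      rintro n _ rfl
      obtain ⟨z, z', hz, h1, h2⟩ := h.exists_near n
      rw [← h.invariant] at h1 h2
      exact ⟨z', z, step_iff.2 hz, h2, h1⟩
    exact aux (u.apply_symm_apply m).symm

theorem SupLTOne.comp {f : M → ℝ} (h : SupLTOne f) (s : M → M) : SupLTOne fun m => f (s m) :=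
  h.imp fun _ h => ⟨h.1, fun _ => h.2 _⟩

theorem SupLTOne.exists_mul_le {l : M → ℝ≥0} (h : SupLTOne fun m => (l m : ℝ)) (η : M → ℝ≥0) :
    ∃ θ : ℝ, θ < 1 ∧ ∀ m, (l m : ℝ) * η m ≤ θ * η m :=
  h.imp fun _ h => ⟨h.1, fun m => mul_le_mul_of_nonneg_right (h.2 m) (NNReal.coe_nonneg _)⟩

end Dual

/-! ### The intersection of the center-stable and center-unstable graphs. -/

section Center

variable {S C U : Type*} [MetricSpace S] [MetricSpace C] [MetricSpace U]

/-- The center distance is the largest of the three: otherwise the bounds `a, b ≤ 1` reduce the two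
Lipschitz inequalities to one with factor `a * b < 1`, which forces the distances to vanish. -/
theorem dist_le_of_graphs {a b : ℝ≥0} {f : C × U → S} {g : S × C → U}
    (hf : LipschitzWith a f) (hg : LipschitzWith b g) (ha : a ≤ 1) (hb : b ≤ 1)
    (hab : (a : ℝ) * b < 1) {s s' : S} {c c' : C} {w w' : U} (hs : s = f (c, w))
    (hs' : s' = f (c', w')) (hw : w = g (s, c)) (hw' : w' = g (s', c')) :
    dist s s' ≤ dist c c' ∧ dist w w' ≤ dist c c' := by
  have h1 := hf.dist_le_mul (c, w) (c', w')
  have h2 := hg.dist_le_mul (s, c) (s', c')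
  rw [← hs, ← hs', Prod.dist_eq] at h1
  rw [← hw, ← hw', Prod.dist_eq] at h2
  simp only at h1 h2
  have ha' : (a : ℝ) ≤ 1 := ha
  have hb' : (b : ℝ) ≤ 1 := hb
  have a0 : (0 : ℝ) ≤ a := NNReal.coe_nonneg _
  have b0 : (0 : ℝ) ≤ b := NNReal.coe_nonneg _
  have c0 : 0 ≤ dist c c' := dist_nonneg
  have s0 : 0 ≤ dist s s' := dist_nonneg
  have w0 : 0 ≤ dist w w' := dist_nonneg
  have hw1 : dist w w' ≤ dist c c' := by
    rcases le_total (dist s s') (dist c c') with h | h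
    · rw [max_eq_right h] at h2
      nlinarith
    · rw [max_eq_left h] at h2
      rcases le_total (dist c c') (dist w w') with h' | h'
      · rw [max_eq_right h'] at h1
        have : (1 - (a : ℝ) * b) * dist w w' ≤ 0 := by nlinarith
        nlinarith
      · exact h'
  rw [max_eq_left hw1] at h1
  exact ⟨by nlinarith, hw1⟩

/-- For fixed `c`, the intersection is the fixed point of `s ↦ f (c, g (s, c))`, a contraction with
factor `a * b`. -/
theorem exists_center [CompleteSpace S] {a b : ℝ≥0} {f : C × U → S} {g : S × C → U}
    (hf : LipschitzWith a f) (hg : LipschitzWith b g) (hab : (a : ℝ) * b < 1) (s₀ : S) (c : C) :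
    ∃ s w, s = f (c, w) ∧ w = g (s, c) := by
  obtain ⟨s, hs, -⟩ := existsUnique_graph_inter s₀ (g := fun s => g (s, c)) (k := fun w => f (c, w))
    (K := b) (L := a)
    (LipschitzWith.of_dist_le_mul fun s s' => by simpa using hg.dist_le_mul (s, c) (s', c))
    (LipschitzWith.of_dist_le_mul fun w w' => by simpa using hf.dist_le_mul (c, w) (c, w')) hab
  exact ⟨s, _, hs, rfl⟩

end Center

/-! ### The two dichotomies contained in the trichotomy. -/

section Trichotomy

variable {M : Type*} {Xs Xc Xu : M → Type*}
  [∀ m, MetricSpace (Xs m)] [∀ m, MetricSpace (Xc m)] [∀ m, MetricSpace (Xu m)]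
  {u : Equiv.Perm M}
  {H : ∀ m, Xs m × Xc m × Xu m → Xs (u m) × Xc (u m) × Xu (u m) → Prop}
  {Fcs : ∀ m, Xs m × Xc m → Xu (u m) → Xs (u m) × Xc (u m)}
  {Gcs : ∀ m, Xs m × Xc m → Xu (u m) → Xu m}
  {Fcu : ∀ m, Xs m → Xc (u m) × Xu (u m) → Xs (u m)}
  {Gcu : ∀ m, Xs m → Xc (u m) × Xu (u m) → Xc m × Xu m}
  {αu lu βcs lcs αcu lcu βs ls : M → ℝ≥0}

theorem HT.exists_bound (h : HT u H Fcs Gcs Fcu Gcu αu lu βcs lcs αcu lcu βs ls) :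
    ∃ K : ℝ, ∀ m, ((αu m : ℝ) ≤ K ∧ (lu m : ℝ) ≤ K ∧ (βcs m : ℝ) ≤ K ∧ (lcs m : ℝ) ≤ K) ∧
      (αcu m : ℝ) ≤ K ∧ (lcu m : ℝ) ≤ K ∧ (βs m : ℝ) ≤ K ∧ (ls m : ℝ) ≤ K := by
  obtain ⟨K1, h1⟩ := h.bdd_αu
  obtain ⟨K2, h2⟩ := h.bdd_lu
  obtain ⟨K3, h3⟩ := h.bdd_βcs
  obtain ⟨K4, h4⟩ := h.bdd_lcs
  obtain ⟨K5, h5⟩ := h.bdd_αcu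
  obtain ⟨K6, h6⟩ := h.bdd_lcu
  obtain ⟨K7, h7⟩ := h.bdd_βs
  obtain ⟨K8, h8⟩ := h.bdd_ls
  refine ⟨((K1 + K2 + K3 + K4 + K5 + K6 + K7 + K8 : ℝ≥0) : ℝ), fun m => ?_⟩
  have g1 : (αu m : ℝ) ≤ K1 := h1 ⟨m, rfl⟩
  have g2 : (lu m : ℝ) ≤ K2 := h2 ⟨m, rfl⟩
  have g3 : (βcs m : ℝ) ≤ K3 := h3 ⟨m, rfl⟩
  have g4 : (lcs m : ℝ) ≤ K4 := h4 ⟨m, rfl⟩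
  have g5 : (αcu m : ℝ) ≤ K5 := h5 ⟨m, rfl⟩
  have g6 : (lcu m : ℝ) ≤ K6 := h6 ⟨m, rfl⟩
  have g7 : (βs m : ℝ) ≤ K7 := h7 ⟨m, rfl⟩
  have g8 : (ls m : ℝ) ≤ K8 := h8 ⟨m, rfl⟩
  push_cast
  have := K1.coe_nonneg
  have := K2.coe_nonneg
  have := K3.coe_nonneg
  have := K4.coe_nonneg
  have := K5.coe_nonneg
  have := K6.coe_nonneg
  have := K7.coe_nonneg
  have := K8.coe_nonneg
  refine ⟨⟨?_, ?_, ?_, ?_⟩, ?_, ?_, ?_, ?_⟩ <;> linarith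

theorem HT.dichotomy_cs (h : HT u H Fcs Gcs Fcu Gcu αu lu βcs lcs αcu lcu βs ls) :
    Dichotomy (Z := fun m => Xs m × Xc m × Xu m) (X := fun m => Xs m × Xc m) (Y := Xu)
      u H (fun _ z => (z.1, z.2.1)) (fun _ z => z.2.2) αu lu βcs lcs where
  dist_eq m z w := by simp only [Prod.dist_eq, max_assoc]
  exists_mk _ x y := ⟨(x.1, x.2, y), rfl, rfl⟩
  gen m x y := ⟨(x.1, x.2, Gcs m x y), ((Fcs m x y).1, (Fcs m x y).2, y),
    (h.gen_cs m x (Gcs m x y) (Fcs m x y) y).2 ⟨rfl, rfl⟩, rfl, rfl⟩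
  condA m z z' w w' hz hw := h.condA_cs m (z.1, z.2.1) z.2.2 (z'.1, z'.2.1) z'.2.2
    (w.1, w.2.1) w.2.2 (w'.1, w'.2.1) w'.2.2 hz hw
  condB m z z' w w' hz hw := h.condB_cs m (z.1, z.2.1) z.2.2 (z'.1, z'.2.1) z'.2.2
    (w.1, w.2.1) w.2.2 (w'.1, w'.2.1) w'.2.2 hz hw
  mono := h.mono_αu
  anti := h.anti_βcs
  angle := h.angle_su.imp fun _ k => ⟨k.1, fun m => (mul_le_mul_of_nonneg_left
    (NNReal.coe_le_coe.2 (h.βcs_le_βs m)) (NNReal.coe_nonneg _)).trans (k.2 m)⟩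
  spec := h.spec_cs
  bdd := h.exists_bound.imp fun _ k m => (k m).1

theorem HT.dichotomy_s (h : HT u H Fcs Gcs Fcu Gcu αu lu βcs lcs αcu lcu βs ls) :
    Dichotomy (Z := fun m => Xs m × Xc m × Xu m) (X := Xs) (Y := fun m => Xc m × Xu m)
      u H (fun _ z => z.1) (fun _ z => z.2) αcu lcu βs ls where
  dist_eq _ _ _ := rfl
  exists_mk _ x y := ⟨(x, y), rfl, rfl⟩
  gen m x y := ⟨(x, Gcu m x y), (Fcu m x y, y),
    (h.gen_cu m x (Gcu m x y) (Fcu m x y) y).2 ⟨rfl, rfl⟩, rfl, rfl⟩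
  condA m z z' w w' hz hw := h.condA_cu m z.1 z.2 z'.1 z'.2 w.1 w.2 w'.1 w'.2 hz hw
  condB m z z' w w' hz hw := h.condB_cu m z.1 z.2 z'.1 z'.2 w.1 w.2 w'.1 w'.2 hz hw
  mono := h.mono_αcu
  anti := h.anti_βs
  angle := h.angle_su.imp fun _ k => ⟨k.1, fun m => (mul_le_mul_of_nonneg_right
    (NNReal.coe_le_coe.2 (h.αcu_le_αu m)) (NNReal.coe_nonneg _)).trans (k.2 m)⟩
  spec := h.spec_cu
  bdd := h.exists_bound.imp fun _ k m => (k m).2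

/-- For the factor `1` the two growth conditions give `η (u m) = η m`. The step prescribed by the
generating map then has exactly the two assumed errors, so either splitting leads to the same
notion. -/
theorem HT.nearInvariant (h : HT u H Fcs Gcs Fcu Gcu αu lu βcs lcs αcu lcu βs ls)
    {i : ∀ m, Xs m × Xc m × Xu m}
    (hi : IsPseudoInvariantSection (X := fun m => Xs m × Xc m) (Y := Xu) u Fcs Gcs 1
            (fun m => ((i m).1, (i m).2.1)) (fun m => (i m).2.2) ∨
          IsPseudoInvariantSection (X := Xs) (Y := fun m => Xc m × Xu m) u Fcu Gcu 1
            (fun m => (i m).1) (fun m => (i m).2)) :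
    ∃ η, NearInvariant (Z := fun m => Xs m × Xc m × Xu m) H i η := by
  rcases hi with ⟨η, h1, h2, h3, h4⟩ | ⟨η, h1, h2, h3, h4⟩
  · simp only [Pi.one_apply, one_mul] at h3 h4
    have hη : ∀ m, η (u m) = η m := fun m => le_antisymm (h3 m) (h4 m)
    refine ⟨η, hη, fun m => ?_⟩
    obtain ⟨z, z', hz, hx, hy⟩ := h.dichotomy_cs.gen m ((i m).1, (i m).2.1) (i (u m)).2.2
    obtain ⟨g1, g2⟩ := (h.gen_cs m (z.1, z.2.1) z.2.2 (z'.1, z'.2.1) z'.2.2).1 hz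
    have a1 := h1 m
    have a2 := h2 m
    rw [show (z.1, z.2.1) = _ from hx, show z'.2.2 = _ from hy] at g1 g2
    rw [← g2, hη] at a1
    rw [← g1, dist_comm] at a2
    refine ⟨z, z', hz, ?_, ?_⟩
    · rw [h.dichotomy_cs.dist_eq, hx, dist_self]
      exact max_le (NNReal.coe_nonneg _) a2
    · rw [h.dichotomy_cs.dist_eq, hy, dist_self]
      rw [dist_comm] at a1
      exact max_le a1 (NNReal.coe_nonneg _)
  · simp only [Pi.one_apply, one_mul] at h3 h4
    have hη : ∀ m, η (u m) = η m := fun m => le_antisymm (h3 m) (h4 m)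
    refine ⟨η, hη, fun m => ?_⟩
    obtain ⟨z, z', hz, hx, hy⟩ := h.dichotomy_s.gen m (i m).1 (i (u m)).2
    obtain ⟨g1, g2⟩ := (h.gen_cu m z.1 z.2 z'.1 z'.2).1 hz
    have a1 := h1 m
    have a2 := h2 m
    rw [show z.1 = _ from hx, show z'.2 = _ from hy] at g1 g2
    rw [← g2, hη] at a1
    rw [← g1, dist_comm] at a2
    refine ⟨z, z', hz, ?_, ?_⟩
    · rw [h.dichotomy_s.dist_eq, hx, dist_self]
      exact max_le (NNReal.coe_nonneg _) a2
    · rw [h.dichotomy_s.dist_eq, hy, dist_self]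
      rw [dist_comm] at a1
      exact max_le a1 (NNReal.coe_nonneg _)

end Trichotomy

end HypTri

/-! ### Assembly of the theorem. -/

theorem theorem4p10 {M : Type*} {Xs Xc Xu : M → Type*}
    [∀ m, MetricSpace (Xs m)] [∀ m, CompleteSpace (Xs m)]
    [∀ m, MetricSpace (Xc m)] [∀ m, CompleteSpace (Xc m)]
    [∀ m, MetricSpace (Xu m)] [∀ m, CompleteSpace (Xu m)]
    (u : Equiv.Perm M)
    (H : ∀ m, Xs m × Xc m × Xu m → Xs (u m) × Xc (u m) × Xu (u m) → Prop)
    (Fcs : ∀ m, Xs m × Xc m → Xu (u m) → Xs (u m) × Xc (u m))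
    (Gcs : ∀ m, Xs m × Xc m → Xu (u m) → Xu m)
    (Fcu : ∀ m, Xs m → Xc (u m) × Xu (u m) → Xs (u m))
    (Gcu : ∀ m, Xs m → Xc (u m) × Xu (u m) → Xc m × Xu m)
    (αu lu βcs lcs αcu lcu βs ls : M → ℝ≥0)
    (hHT : HT u H Fcs Gcs Fcu Gcu αu lu βcs lcs αcu lcu βs ls)
    (i : ∀ m, Xs m × Xc m × Xu m)
    (hi : IsPseudoInvariantSection (X := fun m => Xs m × Xc m) (Y := Xu) u Fcs Gcs 1
            (fun m => ((i m).1, (i m).2.1)) (fun m => (i m).2.2) ∨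
          IsPseudoInvariantSection (X := Xs) (Y := fun m => Xc m × Xu m) u Fcu Gcu 1
            (fun m => (i m).1) (fun m => (i m).2))
    (ς : ℝ) (hς : 0 < ς) (e₁ e₂ t₁ t₂ : M → ℝ)
    (he₁ : AdmissibleRate lcs lu ς e₁) (he₁_one : ∀ m, 1 ≤ e₁ m)
    (he₂ : AdmissibleRate lcu ls ς e₂) (he₂_one : ∀ m, 1 ≤ e₂ m)
    (ht₁ : AdmissibleRate ls lcu ς t₁) (ht₂ : AdmissibleRate lu lcs ς t₂) :
    ∃ Wcs Wcu Wc : ∀ m, Set (Xs m × Xc m × Xu m),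
      -- the center-stable and center-unstable graphs, their invariance, their growth rates
      ((∀ m, ∃ f : Xs m × Xc m → Xu m, LipschitzWith (βcs m) f ∧
          Wcs m = {z | z.2.2 = f (z.1, z.2.1)}) ∧
        (∀ m, ∃ f : Xc m × Xu m → Xs m, LipschitzWith (αcu m) f ∧
          Wcu m = {z | z.1 = f z.2}) ∧
        (∀ m, ∀ z ∈ Wcs m, ∃ z' ∈ Wcs (u m), H m z z') ∧
        (∀ m, ∀ z ∈ Wcu m, ∃ z' ∈ Wcu (u.symm m), Step H z' z) ∧
        (∀ m, Wcs m = {z₀ | ∃ z : ∀ k, Xs (baseOrbit u m k) × Xc (baseOrbit u m k) ×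
            Xu (baseOrbit u m k), IsForwardOrbit H m z ∧ z 0 = z₀ ∧
            Dominated (fun k => dist (z k) (i (baseOrbit u m k))) (cocycle u e₁ m)}) ∧
        (∀ m, Wcu m = {z₀ | ∃ z : ∀ k, Xs (baseOrbit u.symm m k) × Xc (baseOrbit u.symm m k) ×
            Xu (baseOrbit u.symm m k), IsBackwardOrbit H m z ∧ z 0 = z₀ ∧
            Dominated (fun k => dist (z k) (i (baseOrbit u.symm m k)))
              (cocycle u.symm e₂ m)})) ∧
      -- the center graph, and the characterizations by the distance to it
      ((∀ m, Wc m = Wcs m ∩ Wcu m) ∧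
        (∃ K : ℝ≥0, ∀ m, ∃ f : Xc m → Xs m × Xu m, LipschitzWith K f ∧
          Wc m = {z | (z.1, z.2.2) = f z.2.1}) ∧
        (∀ m, ∀ z ∈ Wc m, ∃ z' ∈ Wc (u m), H m z z') ∧
        (∀ m, ∀ z ∈ Wc m, ∃ z' ∈ Wc (u.symm m), Step H z' z) ∧
        (∀ m, Wcs m = {z₀ | ∃ z : ∀ k, Xs (baseOrbit u m k) × Xc (baseOrbit u m k) ×
            Xu (baseOrbit u m k), IsForwardOrbit H m z ∧ z 0 = z₀ ∧
            Tendsto (fun k => Metric.infDist (z k) (Wc (baseOrbit u m k))) atTop (𝓝 0)}) ∧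
        (∀ m, Wcs m = {z₀ | ∃ z : ∀ k, Xs (baseOrbit u m k) × Xc (baseOrbit u m k) ×
            Xu (baseOrbit u m k), IsForwardOrbit H m z ∧ z 0 = z₀ ∧
            BddAbove (Set.range fun k => Metric.infDist (z k) (Wc (baseOrbit u m k)))}) ∧
        (∀ m, Wcu m = {z₀ | ∃ z : ∀ k, Xs (baseOrbit u.symm m k) × Xc (baseOrbit u.symm m k) ×
            Xu (baseOrbit u.symm m k), IsBackwardOrbit H m z ∧ z 0 = z₀ ∧
            Tendsto (fun k => Metric.infDist (z k) (Wc (baseOrbit u.symm m k)))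
              atTop (𝓝 0)}) ∧
        (∀ m, Wcu m = {z₀ | ∃ z : ∀ k, Xs (baseOrbit u.symm m k) × Xc (baseOrbit u.symm m k) ×
            Xu (baseOrbit u.symm m k), IsBackwardOrbit H m z ∧ z 0 = z₀ ∧
            BddAbove (Set.range fun k =>
              Metric.infDist (z k) (Wc (baseOrbit u.symm m k)))})) ∧
      -- exponential tracking and shadowing orbits
      ((∀ m, ∀ z : ∀ k, Xs (baseOrbit u m k) × Xc (baseOrbit u m k) × Xu (baseOrbit u m k),
          IsForwardOrbit H m z →
          ∃ z' : ∀ k, Xs (baseOrbit u m k) × Xc (baseOrbit u m k) × Xu (baseOrbit u m k),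
            IsForwardOrbit H m z' ∧ (∀ k, z' k ∈ Wcu (baseOrbit u m k)) ∧
            Dominated (fun k => dist (z k) (z' k)) (cocycle u t₁ m)) ∧
        (∀ m, ∀ z : ∀ k, Xs (baseOrbit u.symm m k) × Xc (baseOrbit u.symm m k) ×
            Xu (baseOrbit u.symm m k),
          IsBackwardOrbit H m z →
          ∃ z' : ∀ k, Xs (baseOrbit u.symm m k) × Xc (baseOrbit u.symm m k) ×
              Xu (baseOrbit u.symm m k),
            IsBackwardOrbit H m z' ∧ (∀ k, z' k ∈ Wcs (baseOrbit u.symm m k)) ∧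
            Dominated (fun k => dist (z k) (z' k)) (cocycle u.symm t₂ m))) ∧
      -- the bundle maps induced by `H` and its inversion on the graphs, and the reduced maps
      ∃ (Hcs : ∀ m, Wcs m → Wcs (u m)) (Hcu : ∀ m, Wcu m → Wcu (u.symm m))
        (Hc : ∀ m, Wc m → Wc (u m)),
        ((∀ m (z : Wcs m) (z' : Wcs (u m)), H m z.1 z'.1 ↔ z' = Hcs m z) ∧
          (∀ m (z : Wcu m) (z' : Wcu (u.symm m)), Step H z'.1 z.1 ↔ z' = Hcu m z) ∧
          (∀ m (z : Wc m) (z' : Wc (u m)), H m z.1 z'.1 ↔ z' = Hc m z) ∧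
          (∃ hcs : ∀ m, Xs m × Xc m → Xs (u m) × Xc (u m),
            (∀ m, LipschitzWith (lcs m) (hcs m)) ∧
            ∀ m (z : Wcs m), ((Hcs m z).1.1, (Hcs m z).1.2.1) = hcs m (z.1.1, z.1.2.1)) ∧
          (∃ hcu : ∀ m, Xc m × Xu m → Xc (u.symm m) × Xu (u.symm m),
            (∀ m, LipschitzWith (lcu (u.symm m)) (hcu m)) ∧
            ∀ m (z : Wcu m), (Hcu m z).1.2 = hcu m z.1.2) ∧
          (∃ hc : ∀ m, Xc m ≃ Xc (u m),
            (∀ m, LipschitzWith (lcs m) (hc m)) ∧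
            (∀ m, LipschitzWith (lcu m) (hc m).symm) ∧
            ∀ m (z : Wc m), (Hc m z).1.2.1 = hc m z.1.2.1)) ∧
        -- the strong stable and strong unstable leaves, and the bundles over `Wc`
        ∃ Wss Wuu : ∀ m, Xs m × Xc m × Xu m → Set (Xs m × Xc m × Xu m),
          (∀ m, ∀ z ∈ Wcs m, ∃ f : Xs m → Xc m × Xu m, LipschitzWith (βs m) f ∧
            Wss m z = {z' | z'.2 = f z'.1}) ∧
          (∀ m, ∀ z ∈ Wcu m, ∃ f : Xu m → Xs m × Xc m, LipschitzWith (αu m) f ∧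
            Wuu m z = {z' | (z'.1, z'.2.1) = f z'.2.2}) ∧
          (∀ m, ∀ z ∈ Wcs m, z ∈ Wss m z ∧ Wss m z ⊆ Wcs m) ∧
          (∀ m, ∀ z ∈ Wcu m, z ∈ Wuu m z ∧ Wuu m z ⊆ Wcu m) ∧
          (∀ m (z z' : Wcs m), z'.1 ∈ Wss m z.1 → (Hcs m z').1 ∈ Wss (u m) (Hcs m z).1) ∧
          (∀ m (z z' : Wcu m), z'.1 ∈ Wuu m z.1 → (Hcu m z').1 ∈ Wuu (u.symm m) (Hcu m z).1) ∧
          (∀ m (z z' : Wcs m), z'.1 ∈ Wss m z.1 ↔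
            Dominated (fun k => dist (iterateMap (Z := fun m => Wcs m) Hcs m k z').1
              (iterateMap (Z := fun m => Wcs m) Hcs m k z).1) (cocycle u t₁ m)) ∧
          (∀ m (z z' : Wcu m), z'.1 ∈ Wuu m z.1 ↔
            Dominated (fun k => dist (iterateMap (Z := fun m => Wcu m) Hcu m k z').1
              (iterateMap (Z := fun m => Wcu m) Hcu m k z).1) (cocycle u.symm t₂ m)) ∧
          (∃ p : ∀ m, Wcs m → Wc m, ∀ m, Function.Surjective (p m) ∧
            ∀ (z : Wcs m) (w : Wc m), p m z = w ↔ z.1 ∈ Wss m w.1) ∧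
          (∃ p : ∀ m, Wcu m → Wc m, ∀ m, Function.Surjective (p m) ∧
            ∀ (z : Wcu m) (w : Wc m), p m z = w ↔ z.1 ∈ Wuu m w.1) ∧
          (∀ m, Set.BijOn
            (fun t : (Xs m × Xc m × Xu m) × (Xs m × Xc m × Xu m) × (Xs m × Xc m × Xu m) =>
              (t.2.1.1, t.1.2.1, t.2.2.2.2))
            {t | t.1 ∈ Wc m ∧ t.2.1 ∈ Wss m t.1 ∧ t.2.2 ∈ Wuu m t.1} Set.univ) := by
  have Dcs := hHT.dichotomy_cs
  have Ds := hHT.dichotomy_s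
  have Dcu := Ds.dual
  have Du := Dcs.dual
  obtain ⟨η, hi⟩ := hHT.nearInvariant hi
  obtain ⟨K, hK⟩ := hHT.exists_bound
  have bls : ∀ m, (ls m : ℝ) ≤ K := fun m => (hK m).2.2.2.2
  have blcu : ∀ m, (lcu m : ℝ) ≤ K := fun m => (hK m).2.2.1
  have blu : ∀ m, (lu m : ℝ) ≤ K := fun m => (hK m).1.2.1
  have blcs : ∀ m, (lcs m : ℝ) ≤ K := fun m => (hK m).1.2.2.2
  have slu : SupLTOne fun m => ((lu ∘ u.symm) m : ℝ) := hHT.spec_u.comp u.symm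
  have sls : SupLTOne fun m => ((ls ∘ u.symm) m : ℝ) := hHT.spec_s.comp u.symm
  obtain ⟨θ, hθ, hθη⟩ := hHT.spec_u.exists_mul_le η
  obtain ⟨θ', hθ', hθη'⟩ := sls.exists_mul_le η
  obtain ⟨fcs, hfcs, E, hE, hE1, hE2⟩ := Dcs.exists_graph hi hθ hθη
  obtain ⟨fcu, hfcu, E', hE', hE1', hE2'⟩ := Dcu.exists_graph hi.dual hθ' hθη'
  have hαcu : ∀ m, (αcu ∘ u.symm) m ≤ αcu m := fun m => by
    simpa using hHT.mono_αcu (u.symm m)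
  have hαu : ∀ m, (αu ∘ u.symm) m ≤ αu m := fun m => by
    simpa using hHT.mono_αu (u.symm m)
  have hang : ∀ m, αu m * βs m < 1 := fun m => by
    obtain ⟨φ, p1, p⟩ := hHT.angle_su
    exact_mod_cast (p m).trans_lt p1
  have hγ : ∀ m, (((αcu ∘ u.symm) m : ℝ≥0) : ℝ) * βs m < 1 := fun m => by
    have : (αcu ∘ u.symm) m * βs m < 1 :=
      (mul_le_mul' ((hαcu m).trans (hHT.αcu_le_αu m)) le_rfl).trans_lt (hang m)
    exact_mod_cast this
  have hγ' : ∀ m, (βcs m : ℝ) * (((αu ∘ u.symm) m : ℝ≥0) : ℝ) < 1 := fun m => by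
    have : (αu ∘ u.symm) m * βcs m < 1 :=
      (mul_le_mul' (hαu m) (hHT.βcs_le_βs m)).trans_lt (hang m)
    rw [mul_comm]
    exact_mod_cast this
  have hab : ∀ m, (((αcu ∘ u.symm) m : ℝ≥0) : ℝ) * βcs m < 1 := fun m =>
    (mul_le_mul_of_nonneg_left (NNReal.coe_le_coe.2 (hHT.βcs_le_βs m))
      (NNReal.coe_nonneg _)).trans_lt (hγ m)
  set Wcs := graphSet (Z := fun m => Xs m × Xc m × Xu m) (fun _ z => (z.1, z.2.1))
    (fun _ z => z.2.2) fcs.1 with hWcs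
  set Wcu := graphSet (Z := fun m => Xs m × Xc m × Xu m) (fun _ z => z.2)
    (fun _ z => z.1) fcu.1 with hWcu
  -- forward invariance of `Wcu`, backward invariance of `Wcs`
  have hVcu : ∀ m z z', H m z z' → z ∈ Wcu m → z' ∈ Wcu (u m) := by
    have aux : ∀ {n m : M} (_ : n = u.symm m) (z : Xs n × Xc n × Xu n)
        (z' : Xs m × Xc m × Xu m), Step (Z := fun m => Xs m × Xc m × Xu m) H z z' →
        z ∈ Wcu n → z' ∈ Wcu m := by
      rintro _ m rfl z z' h hz
      exact Dcu.mem_graph_of_step hfcu h hz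
    exact fun m z z' h => aux (u.symm_apply_apply m).symm z z' (step_iff.2 h)
  have hVcs : ∀ m z z', inverseStep (Z := fun m => Xs m × Xc m × Xu m) H m z z' →
      z ∈ Wcs m → z' ∈ Wcs (u.symm m) := by
    have aux : ∀ {n m : M} (_ : m = u n) (z : Xs m × Xc m × Xu m)
        (z' : Xs n × Xc n × Xu n), Step (Z := fun m => Xs m × Xc m × Xu m) H z' z →
        z ∈ Wcs m → z' ∈ Wcs n := by
      rintro n _ rfl z z' h hz
      exact Dcs.mem_graph_of_step hfcs (step_iff.1 h) hz
    exact fun m z z' h => aux (u.apply_symm_apply m).symm z z' h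
  obtain ⟨Hcs, hHcs, hcs, hcsL, hcsH⟩ := Dcs.exists_graphMap hfcs
  obtain ⟨Hcu, hHcu, hcu, hcuL, hcuH⟩ := Dcu.exists_graphMap hfcu
  let Wc : ∀ m, Set (Xs m × Xc m × Xu m) := fun m => Wcs m ∩ Wcu m
  have hCcs : ∀ m z, z ∈ Wc m ↔ z ∈ Wcs m ∧ z ∈ Wcu m := fun _ _ => Iff.rfl
  have hCcu : ∀ m z, z ∈ Wc m ↔ z ∈ Wcu m ∧ z ∈ Wcs m := fun _ _ => and_comm
  -- the center graph
  have hcenter : ∀ m (c : Xc m), ∃ z ∈ Wc m, z.2.1 = c := fun m c => by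
    obtain ⟨s, w, h1, h2⟩ := exists_center (fcu.2 m) (fcs.2 m) (hab m) (i m).1 c
    exact ⟨(s, c, w), ⟨h2, h1⟩, rfl⟩
  have hcdist : ∀ m, ∀ z ∈ Wc m, ∀ w ∈ Wc m, dist z.1 w.1 ≤ dist z.2.1 w.2.1 ∧
      dist z.2.2 w.2.2 ≤ dist z.2.1 w.2.1 := fun m z hz w hw =>
    dist_le_of_graphs (fcu.2 m) (fcs.2 m) ((hαcu m).trans (hHT.αcu_le_one m)) (hHT.βcs_le_one m)
      (hab m) hz.2 hw.2 hz.1 hw.1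
  have hcuniq : ∀ m, ∀ z ∈ Wc m, ∀ w ∈ Wc m, z.2.1 = w.2.1 → z = w := fun m z hz w hw h => by
    obtain ⟨h1, h2⟩ := hcdist m z hz w hw
    rw [h, dist_self] at h1 h2
    exact Prod.ext (dist_le_zero.1 h1) (Prod.ext h (dist_le_zero.1 h2))
  choose σ hσ hσc using hcenter
  have hWcne : ∀ m, (Wc m).Nonempty := fun m => ⟨_, hσ m (i m).2.1⟩
  -- The map on the center is the restriction of `Hcs`: every successor of a point of `Wcu` is in
  -- `Wcu`, so the one chosen in `Wcs` lies in both.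
  let Hc : ∀ m, Wc m → Wc (u m) := fun m z =>
    ⟨(Hcs m ⟨z.1, z.2.1⟩).1, (Hcs m ⟨z.1, z.2.1⟩).2,
      hVcu m z.1 _ ((hHcs m ⟨z.1, z.2.1⟩ _).2 rfl) z.2.2⟩
  have hHc : ∀ m (z : Wc m) (z' : Wc (u m)), H m z.1 z'.1 ↔ z' = Hc m z := fun m z z' => by
    refine (hHcs m ⟨z.1, z.2.1⟩ ⟨z'.1, z'.2.1⟩).trans ?_
    rw [Subtype.ext_iff, Subtype.ext_iff]
  have hback : ∀ m, ∀ z ∈ Wc m, ∃ z' ∈ Wc (u.symm m),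
      Step (Z := fun m => Xs m × Xc m × Xu m) H z' z := fun m z hz => by
    have h := (hHcu m ⟨z, hz.2⟩ _).2 rfl
    exact ⟨_, ⟨hVcs m z _ h hz.1, (Hcu m ⟨z, hz.2⟩).2⟩, h⟩
  have hback' : ∀ m, ∀ w ∈ Wc (u m), ∃ z ∈ Wc m, H m z w := by
    have aux : ∀ {n m : M} (_ : n = u.symm m), ∀ w ∈ Wc m, ∃ z ∈ Wc n,
        Step (Z := fun m => Xs m × Xc m × Xu m) H z w := by
      rintro _ m rfl
      exact hback m
    exact fun m w hw => (aux (u.symm_apply_apply m).symm w hw).imp fun z h => ⟨h.1, step_iff.1 h.2⟩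
  let hc : ∀ m, Xc m → Xc (u m) := fun m c => (Hc m ⟨σ m c, hσ m c⟩).1.2.1
  have hHcσ : ∀ m c, H m (σ m c) (Hc m ⟨σ m c, hσ m c⟩).1 := fun m c =>
    (hHc m ⟨σ m c, hσ m c⟩ _).2 rfl
  have hcLip : ∀ m, LipschitzWith (lcs m) (hc m) := fun m => by
    refine LipschitzWith.of_dist_le_mul fun c c' => ?_
    have h1 := (Dcs.condB_of_graph (hHcσ m c) (hHcσ m c') (fcs.2 _)
      (Hc m ⟨σ m c, hσ m c⟩).2.1 (Hc m ⟨σ m c', hσ m c'⟩).2.1).2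
    have h2 := (hcdist m _ (hσ m c) _ (hσ m c')).1
    simp only [Prod.dist_eq, hσc] at h1 h2
    rw [max_eq_right h2] at h1
    exact (le_max_right _ _).trans h1
  -- (A) for the splitting `Xs × Xcu` bounds the center distance backwards: this gives injectivity
  -- of `hc` and the Lipschitz constant of its inverse.
  have hcexp : ∀ m c c', dist c c' ≤ lcu m * dist (hc m c) (hc m c') := fun m c c' => by
    have h1 := (hHT.condA_cu m _ _ _ _ _ _ _ _ (hHcσ m c) (hHcσ m c') (by
      have := (fcu.2 m).dist_le_mul (σ m c).2 (σ m c').2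
      rw [← show (σ m c).1 = fcu.1 m (σ m c).2 from (hσ m c).2,
        ← show (σ m c').1 = fcu.1 m (σ m c').2 from (hσ m c').2] at this
      exact this.trans (mul_le_mul_of_nonneg_right (hαcu m) dist_nonneg))).2
    have h2 := (hcdist _ _ (Hc m ⟨σ m c, hσ m c⟩).2 _ (Hc m ⟨σ m c', hσ m c'⟩).2).2
    rw [Prod.dist_eq, Prod.dist_eq, max_eq_left h2, hσc, hσc] at h1
    exact (le_max_left _ _).trans h1
  have hcbij : ∀ m, Function.Bijective (hc m) := fun m => by
    refine ⟨fun c c' h => dist_le_zero.1 ?_, fun c' => ?_⟩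
    · have := hcexp m c c'
      rwa [h, dist_self, mul_zero] at this
    · obtain ⟨z, hz, hzw⟩ := hback' m _ (hσ (u m) c')
      refine ⟨z.2.1, ?_⟩
      have h1 : σ m z.2.1 = z := hcuniq m _ (hσ m _) z hz (hσc m _)
      have h2 := (hHc m ⟨z, hz⟩ ⟨_, hσ (u m) c'⟩).1 hzw
      simp only [hc, h1, ← h2]
      exact hσc _ _
  have r₁ : IsRate u ls lcu t₁ := ht₁.isRate hς
  -- The shifted version is required because `Du` and `Dcu` carry constants composed with `u.symm`.
  have r₂ : IsRate u.symm (lu ∘ u.symm) (lcs ∘ u.symm) t₂ := ht₂.isRate_shift hς blu blcs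
  have rcs : IsRate u lcs lu e₁ := he₁.isRate hς
  have rcu : IsRate u.symm (lcu ∘ u.symm) (ls ∘ u.symm) e₂ := he₂.isRate_shift hς blcu bls
  obtain ⟨pcs, hpcs⟩ := Dcs.exists_leafProjection Ds hfcs hHT.spec_u hHT.spec_s r₁ hHcs fcu.2
    (fun _ _ => Iff.rfl) hγ hCcs
  obtain ⟨pcu, hpcu⟩ := Dcu.exists_leafProjection Du hfcu sls slu r₂ hHcu fcs.2
    (fun _ _ => Iff.rfl) hγ' hCcu
  have infcs := Dcs.mem_graph_iff_infDist Ds hfcs hHT.spec_u hHT.spec_s r₁ hHcs hVcu hCcs hWcne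
    fun m => (hpcs m).2
  have infcu := Dcu.mem_graph_iff_infDist Du hfcu sls slu r₂ hHcu hVcs hCcu hWcne
    fun m => (hpcu m).2
  have hss : ∀ m, ∀ z ∈ Wcs m, ∃ f : Xs m → Xc m × Xu m, LipschitzWith (βs m) f ∧
      strongLeaf Hcs t₁ m z = {z' | z'.2 = f z'.1} := fun m z hz =>
    (Dcs.strongLeaf_eq_graph Ds hfcs hHT.spec_u hHT.spec_s r₁ hHcs m ⟨z, hz⟩).1
  have huu : ∀ m, ∀ z ∈ Wcu m, ∃ f : Xu m → Xs m × Xc m, LipschitzWith (αu m) f ∧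
      strongLeaf Hcu t₂ m z = {z' | (z'.1, z'.2.1) = f z'.2.2} := fun m z hz => by
    obtain ⟨f, hf, h⟩ := (Dcu.strongLeaf_eq_graph Du hfcu sls slu r₂ hHcu m ⟨z, hz⟩).1
    exact ⟨f, hf.weaken (hαu m), h⟩
  refine ⟨Wcs, Wcu, Wc, ⟨fun m => ⟨fcs.1 m, fcs.2 m, rfl⟩,
    fun m => ⟨fcu.1 m, (fcu.2 m).weaken (hαcu m), rfl⟩,
    fun m z hz => ⟨_, (Hcs m ⟨z, hz⟩).2, (hHcs m ⟨z, hz⟩ _).2 rfl⟩,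
    fun m z hz => ⟨_, (Hcu m ⟨z, hz⟩).2, (hHcu m ⟨z, hz⟩ _).2 rfl⟩,
    fun m => Set.ext fun z => Dcs.mem_graph_iff_dominated hfcs hi.invariant hE hE1 hE2 rcs
      (he₁.absorbsErrors hς he₁_one blcs) he₁_one m z,
    fun m => Set.ext fun z => Dcu.mem_graph_iff_dominated hfcu hi.dual.invariant hE' hE1' hE2' rcu
      (he₂.absorbsErrors_shift hς he₂_one blcu) he₂_one m z⟩,
    ⟨fun _ => rfl, ⟨1, fun m => ⟨fun c => ((σ m c).1, (σ m c).2.2),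
      LipschitzWith.of_dist_le_mul fun c c' => ?_, Set.ext fun z => ⟨fun hz => ?_, fun hz => ?_⟩⟩⟩,
      fun m z hz => ⟨_, (Hc m ⟨z, hz⟩).2, (hHc m ⟨z, hz⟩ _).2 rfl⟩, hback,
      fun m => (infcs m).1, fun m => (infcs m).2, fun m => (infcu m).1, fun m => (infcu m).2⟩,
    ⟨fun m z hz => Ds.exists_tracking r₁ hVcu fcu.2 (fun _ _ => Iff.rfl) hγ hz,
      fun m z hz => Du.exists_tracking r₂ hVcs fcs.2 (fun _ _ => Iff.rfl) hγ' hz⟩,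
    Hcs, Hcu, Hc, ⟨hHcs, hHcu, hHc, ⟨hcs, hcsL, hcsH⟩, ⟨hcu, hcuL, hcuH⟩,
      fun m => Equiv.ofBijective (hc m) (hcbij m), hcLip, fun m => ?_, fun m z => ?_⟩,
    strongLeaf Hcs t₁, strongLeaf Hcu t₂, hss, huu,
    fun m z hz => ⟨mem_strongLeaf_self hz, strongLeaf_subset⟩,
    fun m z hz => ⟨mem_strongLeaf_self hz, strongLeaf_subset⟩,
    fun m z z' h => strongLeaf_invariant r₁.pos h, fun m z z' h => strongLeaf_invariant r₂.pos h,
    fun m z z' => mem_strongLeaf_iff z z', fun m z z' => mem_strongLeaf_iff z z',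
    ⟨pcs, hpcs⟩, ⟨pcu, hpcu⟩, fun m => ⟨fun _ _ => trivial, ?_, ?_⟩⟩
  · have h := hcdist m _ (hσ m c) _ (hσ m c')
    rw [hσc, hσc] at h
    rw [Prod.dist_eq, NNReal.coe_one, one_mul]
    exact max_le h.1 h.2
  · have h := hcuniq m _ (hσ m z.2.1) z hz (hσc m _)
    change (z.1, z.2.2) = ((σ m z.2.1).1, (σ m z.2.1).2.2)
    rw [h]
  · have h : (z.1, z.2.2) = ((σ m z.2.1).1, (σ m z.2.1).2.2) := hz
    obtain ⟨h1, h2⟩ := Prod.mk.inj h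
    have : z = σ m z.2.1 := Prod.ext h1 (Prod.ext (hσc m _).symm h2)
    rw [this]
    exact hσ m _
  · refine LipschitzWith.of_dist_le_mul fun c c' => ?_
    have h := hcexp m ((Equiv.ofBijective (hc m) (hcbij m)).symm c)
      ((Equiv.ofBijective (hc m) (hcbij m)).symm c')
    rwa [Equiv.ofBijective_apply_symm_apply (hc m) (hcbij m),
      Equiv.ofBijective_apply_symm_apply (hc m) (hcbij m)] at h
  · have h : (⟨σ m z.1.2.1, hσ m _⟩ : Wc m) = z :=
      Subtype.ext (hcuniq m _ (hσ m _) _ z.2 (hσc m _))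
    change _ = (Hc m ⟨σ m z.1.2.1, hσ m _⟩).1.2.1
    rw [h]
  · rintro ⟨w, zs, zu⟩ ⟨hw, hzs, hzu⟩ ⟨w', zs', zu'⟩ ⟨hw', hzs', hzu'⟩ h
    simp only at hw hzs hzu hw' hzs' hzu'
    obtain ⟨h1, h23⟩ := Prod.mk.inj h
    obtain ⟨h2, h3⟩ := Prod.mk.inj h23
    simp only at h1 h2 h3
    -- The center coordinate determines `w`. After that, `zs` and `zu` lie on fixed leaves and are
    -- determined by their stable and unstable coordinates.
    obtain rfl := hcuniq m w hw w' hw' h2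
    obtain ⟨f, -, hf⟩ := hss m w hw.1
    obtain ⟨g, -, hg⟩ := huu m w hw.2
    rw [hf] at hzs hzs'
    rw [hg] at hzu hzu'
    have a1 : zs.2 = f zs.1 := hzs
    have a2 : zs'.2 = f zs'.1 := hzs'
    have b1 : (zu.1, zu.2.1) = g zu.2.2 := hzu
    have b2 : (zu'.1, zu'.2.1) = g zu'.2.2 := hzu'
    rw [h3, ← b2] at b1
    obtain ⟨b3, b4⟩ := Prod.mk.inj b1
    rw [Prod.ext h1 (by rw [a1, a2, h1]), Prod.ext b3 (Prod.ext b4 h3)]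
  · rintro ⟨s, c, y⟩ -
    obtain ⟨f, -, hf⟩ := hss m (σ m c) (hσ m c).1
    obtain ⟨g, -, hg⟩ := huu m (σ m c) (hσ m c).2
    refine ⟨(σ m c, (s, f s), ((g y).1, (g y).2, y)), ⟨hσ m c, ?_, ?_⟩, ?_⟩
    · rw [hf]; rfl
    · rw [hg]; rfl
    · simp only [hσc]
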